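/- Theorem. Consider the $n\times n\times n$ Rubik's Cube: its cubies sit at the positions $(x,y,z)\in\{0,\dots,n-1\}^3$, a slice is the set of cubies sharing the value of one coordinate, and a move rotates one slice by $90^\circ$, in either direction, about the axis perpendicular to it. A configuration assigns one of six colors to each visible face of each cubie; it is solved if each of the six sides of the cube has a single color and different sides have different colors; it is reachable if it can be obtained from a solved configuration by a finite sequence of moves. Then every reachable configuration of the $n\times n\times n$ Rubik's Cube can be solved in $O(n^2/\log n)$ moves; that is, there is a constant $C>0$ such that for every integer $n\ge 2$ and every reachable configuration of the $n\times n\times n$ cube there is a sequence of at most $C\,n^2/\log n$ moves which transforms it into a solved configuration. -/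

import Mathlib

namespace RubiksCube

/-- One of the six outward directions (equivalently, sides of the big cube): a coordinate axis
together with a sign, `true` being the positive direction and `false` the negative one. -/
abbrev Face : Type := Fin 3 × Bool

/-- The six colors. -/
abbrev Color : Type := Fin 6

/-- The position of a cubie in the `n × n × n` cube. -/
abbrev Position (n : ℕ) : Type := Fin 3 → Fin n

/-- The side of the cubie at `p` that points in direction `f` is visible: it lies on the surface
of the big cube. -/
def Visible {n : ℕ} (p : Position n) (f : Face) : Prop :=
  if f.2 then (p f.1 : ℕ) + 1 = n else (p f.1 : ℕ) = 0

/-- A visible face of a cubie, given by the location of the cubie and the outward direction. -/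
@[ext]
structure Facelet (n : ℕ) where
  pos : Position n
  face : Face
  visible : Visible pos face

/-- Quarter turn about axis `a` on positions: in coordinates centred at the centre of the cube,
`(x_a, x_{a+1}, x_{a+2}) ↦ (x_a, -x_{a+2}, x_{a+1})`. -/
def rotPos {n : ℕ} (a : Fin 3) (p : Position n) : Position n := fun j =>
  if j = a then p a else if j = a + 1 then Fin.rev (p (a + 2)) else p (a + 1)

/-- The inverse of `rotPos`. -/
def unrotPos {n : ℕ} (a : Fin 3) (p : Position n) : Position n := fun j =>
  if j = a then p a else if j = a + 1 then p (a + 2) else Fin.rev (p (a + 1))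

/-- Quarter turn about axis `a` on directions, the linear part of `rotPos`. -/
def rotFace (a : Fin 3) (f : Face) : Face :=
  if f.1 = a then f else if f.1 = a + 1 then (a + 2, f.2) else (a + 1, !f.2)

/-- The inverse of `rotFace`. -/
def unrotFace (a : Fin 3) (f : Face) : Face :=
  if f.1 = a then f else if f.1 = a + 1 then (a + 2, !f.2) else (a + 1, f.2)

theorem unrotPos_rotPos {n : ℕ} (a : Fin 3) (p : Position n) : unrotPos a (rotPos a p) = p := by
  funext j
  fin_cases a <;> fin_cases j <;> simp [unrotPos, rotPos]

theorem rotPos_unrotPos {n : ℕ} (a : Fin 3) (p : Position n) : rotPos a (unrotPos a p) = p := by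
  funext j
  fin_cases a <;> fin_cases j <;> simp [unrotPos, rotPos]

theorem unrotFace_rotFace (a : Fin 3) (f : Face) : unrotFace a (rotFace a f) = f := by
  revert a f; decide

theorem rotFace_unrotFace (a : Fin 3) (f : Face) : rotFace a (unrotFace a f) = f := by
  revert a f; decide

theorem visible_rot {n : ℕ} (a : Fin 3) (p : Position n) (f : Face) (h : Visible p f) :
    Visible (rotPos a p) (rotFace a f) := by
  obtain ⟨j, s⟩ := f
  fin_cases a <;> fin_cases j <;> cases s <;>
    simp [Visible, rotPos, rotFace, Fin.val_rev] at h ⊢ <;> omega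

theorem visible_unrot {n : ℕ} (a : Fin 3) (p : Position n) (f : Face) (h : Visible p f) :
    Visible (unrotPos a p) (unrotFace a f) := by
  obtain ⟨j, s⟩ := f
  fin_cases a <;> fin_cases j <;> cases s <;>
    simp [Visible, unrotPos, unrotFace, Fin.val_rev] at h ⊢ <;> omega

/-- The quarter turn of the whole cube about axis `a`, as a permutation of the facelets. -/
def rot {n : ℕ} (a : Fin 3) : Equiv.Perm (Facelet n) where
  toFun s := ⟨rotPos a s.pos, rotFace a s.face, visible_rot a _ _ s.visible⟩
  invFun s := ⟨unrotPos a s.pos, unrotFace a s.face, visible_unrot a _ _ s.visible⟩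
  left_inv _ := Facelet.ext (unrotPos_rotPos a _) (unrotFace_rotFace a _)
  right_inv _ := Facelet.ext (rotPos_unrotPos a _) (rotFace_unrotFace a _)

theorem rot_pos_axis {n : ℕ} (a : Fin 3) (s : Facelet n) : (rot a s).pos a = s.pos a := by
  simp [rot, rotPos]

theorem rot_symm_pos_axis {n : ℕ} (a : Fin 3) (s : Facelet n) :
    ((rot a).symm s).pos a = s.pos a := by
  simp [rot, unrotPos]

/-- The quarter turn about axis `a` of the single slice of cubies whose `a`-coordinate is `i`;
all facelets of other cubies stay in place. -/
def sliceTurn {n : ℕ} (a : Fin 3) (i : Fin n) : Equiv.Perm (Facelet n) where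
  toFun s := if s.pos a = i then rot a s else s
  invFun s := if s.pos a = i then (rot a).symm s else s
  left_inv s := by
    by_cases h : s.pos a = i
    · simp [h, rot_pos_axis]
    · simp [h]
  right_inv s := by
    by_cases h : s.pos a = i
    · simp [h, rot_symm_pos_axis]
    · simp [h]

/-- A move of the `n × n × n` cube (`2 ≤ n`): turn the slice with coordinate `index` along `axis`
by 90 degrees, in the positive direction if `positive` is `true`, in the other one if not. -/
structure Move (n : ℕ) where
  axis : Fin 3
  index : Fin n
  positive : Bool

/-- Where a move carries each facelet. -/
def Move.perm {n : ℕ} (m : Move n) : Equiv.Perm (Facelet n) :=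
  if m.positive then sliceTurn m.axis m.index else (sliceTurn m.axis m.index).symm

/-- A configuration assigns a color to each visible face of each cubie. -/
abbrev Configuration (n : ℕ) : Type := Facelet n → Color

/-- The configuration after a move: the color seen at a location is the one that the move has
carried there. -/
def Configuration.move {n : ℕ} (c : Configuration n) (m : Move n) : Configuration n :=
  fun s => c (m.perm.symm s)

/-- The configuration after the moves of a list, performed from left to right. -/
def Configuration.moves {n : ℕ} (c : Configuration n) (l : List (Move n)) : Configuration n :=
  l.foldl Configuration.move c

/-- Each side of the big cube is of a single color, and different sides have different colors. -/
def Configuration.IsSolved {n : ℕ} (c : Configuration n) : Prop :=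
  ∃ col : Face → Color, Function.Injective col ∧ ∀ s : Facelet n, c s = col s.face

/-- The configuration can be reached from a solved one by a sequence of moves. -/
def Configuration.IsReachable {n : ℕ} (c : Configuration n) : Prop :=
  ∃ c₀ : Configuration n, c₀.IsSolved ∧ ∃ l : List (Move n), c₀.moves l = c

end RubiksCube

/-! Rotating the whole cube carries a surface cell `(i, j)` through facelets indexed by twenty-four
labels. Every slice turn preserves each such orbit, so a product of moves amounts to one permutation
of labels per orbit.

Commute a turn of the slices in `I` with a turn of the reflected slices of `J` conjugated by a turn
of an extreme slice. In an interior orbit the two factors move a common facelet only if `i ∈ I` and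
`j ∈ J`, and then exactly one. So the commutator is a three-cycle on precisely the orbits in `I ×
J`, for only `2(|I| + |J|) + 4` moves (`ActsAs.cellComm_interior`).

This sharing yields the logarithm. Cut the columns into blocks of width `b`, and within each block
group the rows by the set of columns where they need the cycle. The resulting rectangles cost at
most `2n + 2^b(2b + 4)` moves per block. For `b` about half of `log₂ n` this is `O(n)`, and there
are `O(n / log n)` blocks (`exists_set`, `blockBound_le`). Conjugates of the basic three-cycle under
rotations generate the alternating group (`Label.closure_cycles`), so a bounded number of rounds
realises any family of even permutations on the interior orbits (`exists_interior`). Parity is no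
obstruction there: labels on the same side of the cube have the same color, so an odd permutation
need only be corrected up to a swap inside one side.

The rest is cheap. Corners, middle edges and face centres form an embedded cube of size 2 or 3,
restored in `O(1)` moves by finiteness (`exists_special`). Each remaining edge orbit also takes
`O(1)` moves, a single slice turn correcting parity (`exists_edges`). Done in the order special
cubies, edges, interior, each stage preserves what the earlier ones achieved. -/

namespace RubiksCube

/-! ### Labels and the turns acting on them -/

/-- The 24 orientations of the cube, encoded as the facelets of a corner orbit: the axis of the
face, and for each coordinate axis whether the cubie lies on the far side. -/
abbrev Label : Type := Fin 3 × Bool × Bool × Bool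

namespace Label

/-- The side (far or near) on which a label lies along an axis. -/
def sign (l : Label) (c : Fin 3) : Bool :=
  if c = 0 then l.2.1 else if c = 1 then l.2.2.1 else l.2.2.2

/-- The label with a given face axis and given sides. -/
def mk (f : Fin 3) (e : Fin 3 → Bool) : Label := (f, e 0, e 1, e 2)

/-- Which coordinate of the reference cell (`0`: the extreme one, `1`, `2`: the two coordinates
inside the face) appears along axis `c`. -/
def sym (l : Label) (c : Fin 3) : Fin 3 :=
  if c = l.1 then 0
  else if decide (c = l.1 + 1) = xor (l.sign 0) (xor (l.sign 1) (l.sign 2)) then 1 else 2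

/-- The map underlying `Label.rot`. -/
def rotFun (a : Fin 3) (l : Label) : Label :=
  mk (if l.1 = a then a else if l.1 = a + 1 then a + 2 else a + 1)
    fun j => if j = a then l.sign a else if j = a + 1 then !l.sign (a + 2) else l.sign (a + 1)

/-- The inverse of `rotFun`. -/
def unrotFun (a : Fin 3) (l : Label) : Label :=
  mk (if l.1 = a then a else if l.1 = a + 1 then a + 2 else a + 1)
    fun j => if j = a then l.sign a else if j = a + 1 then l.sign (a + 2) else !l.sign (a + 1)

/-- Quarter turn of labels. -/
def rot (a : Fin 3) : Equiv.Perm Label where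
  toFun := rotFun a
  invFun := unrotFun a
  left_inv := by revert a; decide
  right_inv := by revert a; decide

theorem sign_rot (a : Fin 3) (l : Label) : (rot a l).sign a = l.sign a := by
  revert a l; decide

theorem sign_rot_symm (a : Fin 3) (l : Label) : ((rot a).symm l).sign a = l.sign a := by
  revert a l; decide

theorem sym_rot (a : Fin 3) (l : Label) : (rot a l).sym a = l.sym a := by
  revert a l; decide

theorem sym_rot_symm (a : Fin 3) (l : Label) : ((rot a).symm l).sym a = l.sym a := by
  revert a l; decide

/-- The turn of those slices perpendicular to axis `a` which are selected by `m`. -/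
def turn (a : Fin 3) (m : Fin 3 → Bool → Bool) : Equiv.Perm Label where
  toFun l := if m (l.sym a) (l.sign a) then rot a l else l
  invFun l := if m (l.sym a) (l.sign a) then (rot a).symm l else l
  left_inv l := by
    by_cases h : m (l.sym a) (l.sign a)
    · simp [h, sym_rot, sign_rot]
    · simp [h]
  right_inv l := by
    by_cases h : m (l.sym a) (l.sign a)
    · simp [h, sym_rot_symm, sign_rot_symm]
    · simp [h]

/-- The label with the same sides and the face axis that carries the symbol `k`. -/
def refaceFun (k : Fin 3) (l : Label) : Label :=
  (if l.sym (l.1 + 1) = k then l.1 + 1 else l.1 + 2, l.2)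

/-- Passing to the other facelet of an edge cubie. -/
def reface : Equiv.Perm Label where
  toFun := refaceFun 2
  invFun := refaceFun 1
  left_inv := by decide
  right_inv := by decide

/-- Slices through near cells with symbol in `p`. -/
def nearTurn (p : Fin 3 → Bool) : Equiv.Perm Label := turn 0 fun s b => p s && !b

/-- Slices through far cells with symbol in `q`; near and far agree for the symbols in `m`. -/
def farTurn (q m : Fin 3 → Bool) : Equiv.Perm Label := turn 0 fun s b => q s && (b || m s)

/-- The extreme slice on the far side of axis `2`; symbols in `z` are extreme. -/
def topTurn (z : Fin 3 → Bool) : Equiv.Perm Label := turn 2 fun s b => z s && b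

/-- The commutator of a slice turn and a conjugated slice turn, on labels. -/
def comm (p q m z : Fin 3 → Bool) : Equiv.Perm Label :=
  nearTurn p * ((topTurn z)⁻¹ * farTurn q m * topTurn z) * (nearTurn p)⁻¹ *
    ((topTurn z)⁻¹ * farTurn q m * topTurn z)⁻¹

/-- The basic three-cycle of labels. -/
def cycle : Equiv.Perm Label :=
  Equiv.swap (2, false, false, true) (1, false, false, false) *
    Equiv.swap (1, false, false, false) (1, true, false, false)

-- The two factors share just one moved label, on the far side of axis `2`, and only when `p₁` and
-- `q₂` hold; a commutator of permutations with one common moved point is a three-cycle. The Boolean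
-- hypotheses list the possible coincidences with extreme and central slices, leaving a finite
-- check.
set_option synthInstance.maxSize 1000 in
theorem comm_interior (p₁ p₂ q₁ q₂ m₁ m₂ z₁ z₂ : Bool) (hp₁ : p₁ → !m₁ && !z₁)
    (hp₂ : p₂ → !m₂ && !z₂) (hz₁ : z₁ → !m₁ && !q₁) (hz₂ : z₂ → !m₂ && !q₂) (hm : m₁ → m₂) :
    comm ![false, p₁, p₂] ![false, q₁, q₂] ![false, m₁, m₂] ![true, z₁, z₂] =
      if p₁ && q₂ then cycle else 1 := by
  revert p₁ p₂ q₁ q₂ m₁ m₂ z₁ z₂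
  decide +kernel

-- Here the common moved piece is an edge cubie. Its two facelets lie in the two orbits `(e, 0)` and
-- `(0, e)`, which explains the two nontrivial cases and the conjugation by `reface`.
set_option synthInstance.maxSize 1000 in
theorem comm_edge (p₁ p₂ m₁ m₂ z₁ z₂ : Bool) (hp₁ : p₁ → !m₁ && !z₁)
    (hp₂ : p₂ → !m₂ && !z₂) (hz₁ : z₁ → !m₁) (hz₂ : z₂ → !m₂) (hm : m₁ → m₂) :
    comm ![false, p₁, p₂] ![true, z₁, z₂] ![false, m₁, m₂] ![true, z₁, z₂] =
      if p₁ && z₂ then cycle else if z₁ && p₂ then reface * cycle * reface⁻¹ else 1 := by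
  revert p₁ p₂ m₁ m₂ z₁ z₂
  decide +kernel

/-- Expresses that the two facelets of an edge cubie move together: `m` selects slices for the orbit
`(i, 0)`, `m'` for `(0, i)`. In the former, symbols `0` and `2` both stand for the coordinate `0`,
hence `h₃`. -/
theorem turn_reface (a : Fin 3) (m m' : Fin 3 → Bool → Bool) (h₀ : ∀ b, m' 0 b = m 0 b)
    (h₁ : ∀ b, m' 1 b = m 0 b) (h₂ : ∀ b, m' 2 b = m 1 b) (h₃ : ∀ b, m 2 b = m 0 b) :
    turn a m' = reface * turn a m * reface⁻¹ := by
  have hm : m = ![m 0, m 1, m 0] := by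
    funext s; fin_cases s <;> simp; funext b; exact h₃ b
  have hm' : m' = ![m 0, m 0, m 1] := by
    funext s; fin_cases s <;> simp <;> funext b <;> simp [h₀, h₁, h₂]
  rw [hm, hm']
  generalize m 0 = u
  generalize m 1 = v
  revert a u v
  decide +kernel

/-- The turn of a single slice through the near cells with symbol `1`. -/
def sliceOne : Equiv.Perm Label := turn 0 fun s b => decide (s = 1) && !b

/-- A four-cycle is odd; this supplies the odd permutations of an edge orbit. -/
theorem sign_sliceOne : Equiv.Perm.sign sliceOne = -1 := by
  have : sliceOne = Equiv.swap (2, false, false, true) (1, false, false, false) *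
      Equiv.swap (1, false, false, false) (2, false, true, false) *
      Equiv.swap (2, false, true, false) (1, false, true, true) := by decide
  rw [this, Equiv.Perm.sign_mul, Equiv.Perm.sign_mul, Equiv.Perm.sign_swap (by decide),
    Equiv.Perm.sign_swap (by decide), Equiv.Perm.sign_swap (by decide)]
  rfl

end Label

/-! ### Generating the alternating group -/

open Pointwise in
/-- A transitive permutation group generated by three-cycles contains the alternating group. -/
theorem alternatingGroup_le_closure_of_isThreeCycle {α : Type*} [Fintype α] [DecidableEq α]
    {T : Set (Equiv.Perm α)} (hT : ∀ t ∈ T, t.IsThreeCycle) (hne : T.Nonempty)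
    (htr : ∀ x y, ∃ g ∈ Subgroup.closure T, g x = y) :
    alternatingGroup α ≤ Subgroup.closure T := by
  obtain ⟨t₀, ht₀⟩ := hne
  have htrans : MulAction.IsPretransitive (Subgroup.closure T) α :=
    ⟨fun x y => by
      obtain ⟨g, hg, h⟩ := htr x y
      exact ⟨⟨g, hg⟩, h⟩⟩
  refine Equiv.Perm.alternatingGroup_le_of_isPreprimitive_of_isThreeCycle_mem
    (g := t₀) ⟨?_⟩ (hT _ ht₀) (Subgroup.subset_closure ht₀)
  intro B hB
  rw [MulAction.IsTrivialBlock, or_iff_not_imp_left, Set.not_subsingleton_iff]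
  rintro ⟨x, hx, y, hy, hxy⟩
  -- Primitivity reduces to each generator stabilising a block `B` with two points `x`, `y`:
  -- otherwise `t` moves `B` off itself, and `x`, `y`, `t x`, `t y` are four points in a support of
  -- size three.
  have hstab : Subgroup.closure T ≤ MulAction.stabilizer (Equiv.Perm α) B := by
    rw [Subgroup.closure_le]
    intro t ht
    rw [SetLike.mem_coe, MulAction.mem_stabilizer_iff]
    by_contra hne
    have hdis : Disjoint (t • B) B := by
      have := MulAction.isBlock_iff_smul_eq_or_disjoint.1 hB ⟨t, Subgroup.subset_closure ht⟩
      exact this.resolve_left hne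
    have key : ∀ u ∈ B, t u ∉ B := fun u hu hu' =>
      Set.disjoint_left.1 hdis (Set.smul_mem_smul_set hu) hu'
    have htx := key x hx
    have hty := key y hy
    have hcard := (hT t ht).card_support
    have hsub : ({x, y, t x, t y} : Finset α) ⊆ t.support := by
      have h1 : t x ≠ x := fun h => htx (h.symm ▸ hx)
      have h2 : t y ≠ y := fun h => hty (h.symm ▸ hy)
      intro z hz
      simp only [Finset.mem_insert, Finset.mem_singleton] at hz
      rcases hz with rfl | rfl | rfl | rfl <;> simp [h1, h2]
    have hle := Finset.card_le_card hsub
    rw [hcard, Finset.card_insert_of_notMem, Finset.card_insert_of_notMem,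
      Finset.card_pair] at hle
    · omega
    · simpa using hxy
    · simp only [Finset.mem_insert, Finset.mem_singleton, not_or]
      exact ⟨fun h => htx (h ▸ hy), fun h => hty (h ▸ hy)⟩
    · simp only [Finset.mem_insert, Finset.mem_singleton, not_or]
      exact ⟨hxy, fun h => htx (h ▸ hx), fun h => hty (h ▸ hx)⟩
  refine Set.eq_univ_of_forall fun z => ?_
  obtain ⟨g, hg, rfl⟩ := htr x z
  have := MulAction.mem_stabilizer_iff.1 (hstab hg)
  rw [← this]
  exact Set.smul_mem_smul_set hx

namespace Label

/-- The rotations of the cube, acting on labels. -/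
def rotations : Subgroup (Equiv.Perm Label) := Subgroup.closure (Set.range rot)

/-- The conjugates of the basic three-cycle under rotations. -/
def cycles : Set (Equiv.Perm Label) := {t | ∃ σ ∈ rotations, t = σ * cycle * σ⁻¹}

theorem isThreeCycle_cycle : cycle.IsThreeCycle := by
  have h := Equiv.Perm.isThreeCycle_swap_mul_swap_same (α := Label)
    (a := (1, false, false, false)) (b := (2, false, false, true)) (c := (1, true, false, false))
    (by decide) (by decide) (by decide)
  rwa [Equiv.swap_comm] at h

theorem rot_mem_rotations (a : Fin 3) : rot a ∈ rotations :=
  Subgroup.subset_closure ⟨a, rfl⟩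

theorem conj_mem_closure_cycles {σ g : Equiv.Perm Label} (hσ : σ ∈ rotations)
    (hg : g ∈ Subgroup.closure cycles) : σ * g * σ⁻¹ ∈ Subgroup.closure cycles := by
  induction hg using Subgroup.closure_induction with
  | mem x hx =>
    obtain ⟨τ, hτ, rfl⟩ := hx
    exact Subgroup.subset_closure ⟨σ * τ, mul_mem hσ hτ, by group⟩
  | one => simp
  | mul x y _ _ hx hy => simpa [mul_assoc] using mul_mem hx hy
  | inv x _ hx => simpa [mul_assoc] using inv_mem hx

/-- The reference label. -/
def base : Label := (2, false, false, true)

/-- Transitivity. The cycles are permuted by conjugation with rotations, so the rotations whose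
effect on `base` is imitated by a product of cycles form a subgroup; it remains to find generators
of the rotations in it. -/
theorem exists_mem_closure_cycles (l : Label) : ∃ g ∈ Subgroup.closure cycles, g base = l := by
  have hcyc : cycle ∈ Subgroup.closure cycles :=
    Subgroup.subset_closure ⟨1, one_mem _, by simp⟩
  let S : Subgroup (Equiv.Perm Label) :=
    { carrier := {σ | σ ∈ rotations ∧ ∃ g ∈ Subgroup.closure cycles, g base = σ base}
      one_mem' := ⟨one_mem _, 1, one_mem _, rfl⟩
      mul_mem' := by
        rintro σ τ ⟨hσ, g, hg, hgσ⟩ ⟨hτ, h, hh, hhτ⟩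
        refine ⟨mul_mem hσ hτ, σ * h * σ⁻¹ * g, mul_mem (conj_mem_closure_cycles hσ hh) hg, ?_⟩
        simp [hgσ, hhτ]
      inv_mem' := by
        rintro σ ⟨hσ, g, hg, hgσ⟩
        refine ⟨inv_mem hσ, σ⁻¹ * g⁻¹ * σ,
          by simpa using conj_mem_closure_cycles (inv_mem hσ) (inv_mem hg), ?_⟩
        simp [← hgσ] }
  -- The support of `cycle` consists of `base` and its images under `rot 0` and `rot 0 * rot 2`, in
  -- this cyclic order.
  have h0 : rot 0 ∈ S := ⟨rot_mem_rotations 0, cycle, hcyc, by decide⟩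
  have h02 : rot 0 * rot 2 ∈ S :=
    ⟨mul_mem (rot_mem_rotations 0) (rot_mem_rotations 2), cycle * cycle, mul_mem hcyc hcyc,
      by decide⟩
  have h2 : rot 2 ∈ S := by simpa using mul_mem (inv_mem h0) h02
  -- Euler angles: the rotations are transitive on labels.
  have hall : ∀ l, ∃ i j k : Fin 4,
      (rot 2 ^ (i : ℕ) * rot 0 ^ (j : ℕ) * rot 2 ^ (k : ℕ)) base = l := by
    decide +kernel
  obtain ⟨i, j, k, rfl⟩ := hall l
  exact (mul_mem (mul_mem (pow_mem h2 i) (pow_mem h0 j)) (pow_mem h2 k) : _ ∈ S).2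

theorem closure_cycles : Subgroup.closure cycles = alternatingGroup Label := by
  have h3 : ∀ t ∈ cycles, t.IsThreeCycle := by
    rintro _ ⟨σ, -, rfl⟩
    rw [Equiv.Perm.IsThreeCycle, Equiv.Perm.cycleType_conj]
    exact isThreeCycle_cycle
  refine le_antisymm ?_ (alternatingGroup_le_closure_of_isThreeCycle h3
    ⟨cycle, 1, one_mem _, by simp⟩ fun x y => ?_)
  · rw [Subgroup.closure_le]
    exact fun t ht => (h3 t ht).mem_alternatingGroup
  · obtain ⟨g, hg, hgx⟩ := exists_mem_closure_cycles x
    obtain ⟨h, hh, hhy⟩ := exists_mem_closure_cycles y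
    exact ⟨h * g⁻¹, mul_mem hh (inv_mem hg), by simp [← hgx, hhy]⟩

end Label

/-! ### Counting moves -/

/-- `g` is a product of at most `k` moves. -/
def Cost {n : ℕ} (g : Equiv.Perm (Facelet n)) (k : ℕ) : Prop :=
  ∃ l : List (Equiv.Perm (Facelet n)),
    l.length ≤ k ∧ (∀ x ∈ l, ∃ m : Move n, x = m.perm) ∧ l.prod = g

namespace Cost

variable {n : ℕ} {g h : Equiv.Perm (Facelet n)} {j k : ℕ}

theorem one (k : ℕ) : Cost (1 : Equiv.Perm (Facelet n)) k := ⟨[], by simp, by simp, rfl⟩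

theorem mono (hg : Cost g j) (hjk : j ≤ k) : Cost g k := by
  obtain ⟨l, hl, h⟩ := hg
  exact ⟨l, hl.trans hjk, h⟩

theorem mul (hg : Cost g j) (hh : Cost h k) : Cost (g * h) (j + k) := by
  obtain ⟨l, hl, hm, rfl⟩ := hg
  obtain ⟨l', hl', hm', rfl⟩ := hh
  refine ⟨l ++ l', by simp; omega, fun x hx => ?_, by simp⟩
  rcases List.mem_append.1 hx with hx | hx
  exacts [hm x hx, hm' x hx]

theorem perm (m : Move n) : Cost m.perm 1 := ⟨[m.perm], by simp, by simp, by simp⟩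

/-- A property of permutations which holds for moves and is multiplicative holds for all
products of moves. -/
theorem induction {p : Equiv.Perm (Facelet n) → Prop} (hg : Cost g k) (h1 : p 1)
    (hmul : ∀ x y, p x → p y → p (x * y)) (hinv : ∀ x, p x → p x⁻¹)
    (hturn : ∀ a i, p (sliceTurn a i)) : p g := by
  obtain ⟨l, -, hm, rfl⟩ := hg
  induction l with
  | nil => simpa using h1
  | cons x l ih =>
    rw [List.prod_cons]
    refine hmul _ _ ?_ (ih fun y hy => hm y (List.mem_cons_of_mem _ hy))
    obtain ⟨m, rfl⟩ := hm x List.mem_cons_self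
    unfold Move.perm
    split
    · exact hturn _ _
    · exact hinv _ (hturn _ _)

/-- Transport of products of moves along an assignment which preserves lengths of generators. -/
theorem lift {n' : ℕ} {r : Equiv.Perm (Facelet n) → Equiv.Perm (Facelet n') → Prop}
    (hg : Cost g k) (h1 : r 1 1)
    (hmul : ∀ x y x' y', r x x' → r y y' → r (x * y) (x' * y'))
    (hm : ∀ m : Move n, ∃ m' : Move n', r m.perm m'.perm) : ∃ g', Cost g' k ∧ r g g' := by
  obtain ⟨l, hl, hlm, rfl⟩ := hg
  induction l generalizing k with
  | nil => exact ⟨1, one k, by simpa using h1⟩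
  | cons x l ih =>
    obtain ⟨m, rfl⟩ := hlm x List.mem_cons_self
    obtain ⟨m', hm'⟩ := hm m
    obtain ⟨g', hg', hr⟩ := ih le_rfl fun y hy => hlm y (List.mem_cons_of_mem _ hy)
    refine ⟨m'.perm * g', ((perm m').mul hg').mono ?_, ?_⟩
    · simp at hl; omega
    · rw [List.prod_cons]; exact hmul _ _ _ _ hm' hr

theorem sliceTurn (a : Fin 3) (i : Fin n) : Cost (sliceTurn a i) 1 :=
  perm ⟨a, i, true⟩

theorem inv (hg : Cost g k) : Cost g⁻¹ k := by
  obtain ⟨l, hl, hm, rfl⟩ := hg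
  refine ⟨(l.map fun x => x⁻¹).reverse, by simpa using hl, fun x hx => ?_, ?_⟩
  · simp only [List.mem_reverse, List.mem_map] at hx
    obtain ⟨y, hy, rfl⟩ := hx
    obtain ⟨⟨a, i, b⟩, rfl⟩ := hm y hy
    refine ⟨⟨a, i, !b⟩, ?_⟩
    cases b
    · simp only [Move.perm]; rfl
    · simp only [Move.perm]; rfl
  · rw [List.prod_inv_reverse]

end Cost

theorem rot_pos {n : ℕ} (a : Fin 3) (s : Facelet n) : (rot a s).pos = rotPos a s.pos := rfl

theorem sliceTurn_apply {n : ℕ} (a : Fin 3) (i : Fin n) (s : Facelet n) :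
    sliceTurn a i s = if s.pos a = i then rot a s else s := rfl

theorem sliceTurn_symm_apply {n : ℕ} (a : Fin 3) (i : Fin n) (s : Facelet n) :
    (sliceTurn a i).symm s = if s.pos a = i then (rot a).symm s else s := rfl

/-- Conjugation by a rotation of the whole cube carries a slice turn to a slice turn. -/
theorem exists_rot_mul_sliceTurn {n : ℕ} (a b : Fin 3) (i : Fin n) :
    ∃ m : Move n, rot a * sliceTurn b i * (rot a)⁻¹ = m.perm := by
  by_cases hb : b = a
  · subst hb
    refine ⟨⟨b, i, true⟩, ?_⟩
    rw [mul_inv_eq_iff_eq_mul]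
    ext1 s
    simp only [Move.perm, if_true, Equiv.Perm.mul_apply, sliceTurn_apply, rot_pos_axis]
    split <;> rfl
  · have : b = a + 1 ∨ b = a + 2 := by revert a b; decide
    rcases this with rfl | rfl
    · refine ⟨⟨a + 2, i, true⟩, ?_⟩
      rw [mul_inv_eq_iff_eq_mul]
      ext1 s
      simp only [Move.perm, if_true, Equiv.Perm.mul_apply, sliceTurn_apply]
      have h : (rot a s).pos (a + 2) = s.pos (a + 1) := by
        rw [rot_pos]; fin_cases a <;> simp [rotPos]
      rw [h]
      split
      · obtain ⟨p, ⟨f, e⟩, v⟩ := s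
        refine Facelet.ext ?_ ?_
        · funext j
          fin_cases a <;> fin_cases j <;> simp [rot, rotPos]
        · simp only [rot, Equiv.coe_fn_mk]; clear * -; revert a f e; decide
      · rfl
    · refine ⟨⟨a + 1, i.rev, false⟩, ?_⟩
      rw [mul_inv_eq_iff_eq_mul]
      ext1 s
      simp only [Move.perm, if_false, Equiv.Perm.mul_apply, sliceTurn_apply,
        sliceTurn_symm_apply, Bool.false_eq_true]
      have h : (rot a s).pos (a + 1) = (s.pos (a + 2)).rev := by
        rw [rot_pos]; fin_cases a <;> simp [rotPos]
      rw [h]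
      simp only [Fin.rev_inj]
      split
      · obtain ⟨p, ⟨f, e⟩, v⟩ := s
        refine Facelet.ext ?_ ?_
        · funext j
          fin_cases a <;> fin_cases j <;> simp [rot, rotPos, unrotPos]
        · simp only [rot, Equiv.coe_fn_mk, Equiv.coe_fn_symm_mk]; clear * -; revert a f e; decide
      · rfl

theorem exists_rot_mul_perm {n : ℕ} (a : Fin 3) (m : Move n) :
    ∃ m' : Move n, rot a * m.perm * (rot a)⁻¹ = m'.perm := by
  obtain ⟨b, i, e⟩ := m
  obtain ⟨⟨b', i', e'⟩, h⟩ := exists_rot_mul_sliceTurn a b i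
  cases e
  · refine ⟨⟨b', i', !e'⟩, ?_⟩
    have h' : (rot a * sliceTurn b i * (rot a)⁻¹)⁻¹ = rot a * (sliceTurn b i)⁻¹ * (rot a)⁻¹ := by
      group
    change rot a * (sliceTurn b i)⁻¹ * (rot a)⁻¹ = _
    rw [← h', h]
    cases e' <;> rfl
  · exact ⟨_, h⟩

/-- A rotation of the whole cube need not be performed: conjugation by it just renames the slices,
so it turns moves into moves at no cost. -/
theorem Cost.conj_rot {n : ℕ} {g : Equiv.Perm (Facelet n)} {k : ℕ} (hg : Cost g k) (a : Fin 3) :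
    Cost (rot a * g * (rot a)⁻¹) k := by
  obtain ⟨g', hg', rfl⟩ := hg.lift (r := fun x x' => rot a * x * (rot a)⁻¹ = x') (by simp)
    (by rintro x y _ _ rfl rfl; group) (exists_rot_mul_perm a)
  exact hg'

/-- The simultaneous turn of all slices perpendicular to `a` with index in `A`. -/
def turns {n : ℕ} (a : Fin 3) (A : Finset (Fin n)) : Equiv.Perm (Facelet n) where
  toFun s := if s.pos a ∈ A then rot a s else s
  invFun s := if s.pos a ∈ A then (rot a).symm s else s
  left_inv s := by
    by_cases h : s.pos a ∈ A
    · simp [h, rot_pos_axis]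
    · simp [h]
  right_inv s := by
    by_cases h : s.pos a ∈ A
    · simp [h, rot_symm_pos_axis]
    · simp [h]

theorem turns_apply {n : ℕ} (a : Fin 3) (A : Finset (Fin n)) (s : Facelet n) :
    turns a A s = if s.pos a ∈ A then rot a s else s := rfl

theorem turns_singleton {n : ℕ} (a : Fin 3) (i : Fin n) : turns a {i} = sliceTurn a i := by
  ext1 s; simp [turns_apply, sliceTurn_apply]

theorem Cost.turns {n : ℕ} (a : Fin 3) (A : Finset (Fin n)) : Cost (turns a A) A.card := by
  induction A using Finset.induction_on with
  | empty =>
    have : RubiksCube.turns a (∅ : Finset (Fin n)) = 1 := by ext1 s; simp [turns_apply]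
    rw [this]; exact Cost.one _
  | insert i A hi ih =>
    have : RubiksCube.turns a (insert i A) = RubiksCube.sliceTurn a i * RubiksCube.turns a A := by
      ext1 s
      rw [Equiv.Perm.mul_apply]
      simp only [turns_apply, sliceTurn_apply, Finset.mem_insert]
      by_cases h : s.pos a ∈ A
      · have : s.pos a ≠ i := fun h' => hi (h' ▸ h)
        simp [h, rot_pos_axis, this]
      · simp [h]
    rw [this, Finset.card_insert_of_notMem hi, add_comm]
    exact (Cost.sliceTurn a i).mul ih


/-! ### Orbits of cells and the action of moves on them -/

theorem exists_near_coord {n : ℕ} (v : Fin n) :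
    ∃ (x : Fin n) (d : Bool), x ≤ x.rev ∧ v = if d then x.rev else x := by
  rcases le_total v v.rev with h | h
  · exact ⟨v, false, h, rfl⟩
  · exact ⟨v.rev, true, by simpa using h, by simp⟩

section Place

variable {n : ℕ} [NeZero n]

/-- The coordinate of a cell with near coordinates `0, i, j`: symbol `s`, reflected if `b`. -/
def coord (i j : Fin n) (s : Fin 3) (b : Bool) : Fin n :=
  if b then (![0, i, j] s).rev else ![0, i, j] s

/-- The rotated copy, with label `l`, of the cell with coordinates `(i, j)` on a face. -/
def place (i j : Fin n) (l : Label) : Facelet n where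
  pos c := coord i j (l.sym c) (l.sign c)
  face := (l.1, l.sign l.1)
  visible := by
    have h : l.sym l.1 = 0 := by simp [Label.sym]
    have := Nat.pos_of_neZero n
    simp only [Visible, h, coord]
    cases l.sign l.1 <;> simp [Fin.val_rev]; omega

theorem coord_not (i j : Fin n) (s : Fin 3) (b : Bool) :
    coord i j s (!b) = (coord i j s b).rev := by
  cases b <;> simp [coord]

theorem rot_place (a : Fin 3) (i j : Fin n) (l : Label) :
    rot a (place i j l) = place i j (Label.rot a l) := by
  have h : ∀ (a : Fin 3) (l : Label), (Label.rot a l).sym a = l.sym a ∧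
      (Label.rot a l).sign a = l.sign a ∧
      (Label.rot a l).sym (a + 1) = l.sym (a + 2) ∧
      (Label.rot a l).sign (a + 1) = !l.sign (a + 2) ∧
      (Label.rot a l).sym (a + 2) = l.sym (a + 1) ∧
      (Label.rot a l).sign (a + 2) = l.sign (a + 1) ∧
      rotFace a (l.1, l.sign l.1) = ((Label.rot a l).1, (Label.rot a l).sign (Label.rot a l).1) :=
    by decide
  obtain ⟨h1, h2, h3, h4, h5, h6, h7⟩ := h a l
  refine Facelet.ext ?_ h7
  funext c
  have hc : c = a ∨ c = a + 1 ∨ c = a + 2 := by clear * -; revert a c; decide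
  have e1 : a + 1 ≠ a := by clear * -; revert a; decide
  have e2 : a + 2 ≠ a := by clear * -; revert a; decide
  have e3 : a + 2 ≠ a + 1 := by clear * -; revert a; decide
  rcases hc with rfl | rfl | rfl
  · simp only [rot_pos, rotPos, place, h1, h2, if_true]
  · simp only [rot_pos, rotPos, place, h3, h4, e1, if_true, if_false, coord_not]
  · simp only [rot_pos, rotPos, place, h5, h6, e2, e3, if_false]

/-- `g` permutes the orbit of the cell `(i, j)` according to the permutation `π` of labels. -/
def ActsAs (g : Equiv.Perm (Facelet n)) (i j : Fin n) (π : Equiv.Perm Label) : Prop :=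
  ∀ l, g (place i j l) = place i j (π l)

namespace ActsAs

variable {g h : Equiv.Perm (Facelet n)} {i j : Fin n} {π ρ : Equiv.Perm Label}

theorem one : ActsAs 1 i j 1 := fun _ => rfl

theorem mul (hg : ActsAs g i j π) (hh : ActsAs h i j ρ) : ActsAs (g * h) i j (π * ρ) :=
  fun l => by rw [Equiv.Perm.mul_apply, hh, hg, Equiv.Perm.mul_apply]

theorem inv (hg : ActsAs g i j π) : ActsAs g⁻¹ i j π⁻¹ := fun l => by
  rw [Equiv.Perm.inv_eq_iff_eq, hg]; simp

theorem rot (a : Fin 3) : ActsAs (rot a) i j (Label.rot a) := rot_place a i j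

theorem turns {a : Fin 3} {A : Finset (Fin n)} {m : Fin 3 → Bool → Bool}
    (hm : ∀ s b, m s b = true ↔ coord i j s b ∈ A) : ActsAs (turns a A) i j (Label.turn a m) := by
  intro l
  have : (place i j l).pos a = coord i j (l.sym a) (l.sign a) := rfl
  simp only [turns_apply, Label.turn, Equiv.coe_fn_mk, hm, this]
  split
  · exact rot_place a i j l
  · rfl

end ActsAs

/-- Whether a slice turn moves a facelet of the orbit depends only on the symbol and sign along its
axis, so it acts through labels. -/
theorem exists_actsAs {g : Equiv.Perm (Facelet n)} {k : ℕ} (hg : Cost g k) (i j : Fin n) :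
    ∃ π, ActsAs g i j π := by
  refine hg.induction (p := fun g => ∃ π, ActsAs g i j π) ⟨1, ActsAs.one⟩ ?_ ?_ ?_
  · rintro x y ⟨π, hπ⟩ ⟨ρ, hρ⟩; exact ⟨_, hπ.mul hρ⟩
  · rintro x ⟨π, hπ⟩; exact ⟨_, hπ.inv⟩
  · intro a x
    rw [← turns_singleton]
    exact ⟨_, ActsAs.turns (m := fun s b => decide (coord i j s b ∈ ({x} : Finset (Fin n))))
      (by simp)⟩

/-- The action on the two facelets of the edge cubies with coordinate `i`. -/
def ActsOnEdge (g : Equiv.Perm (Facelet n)) (i : Fin n) (π : Equiv.Perm Label) : Prop :=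
  ActsAs g i 0 π ∧ ActsAs g 0 i (Label.reface * π * Label.reface⁻¹)

namespace ActsOnEdge

variable {g h : Equiv.Perm (Facelet n)} {i : Fin n} {π ρ : Equiv.Perm Label}

theorem one : ActsOnEdge 1 i 1 := ⟨ActsAs.one, by simpa using ActsAs.one⟩

theorem mul (hg : ActsOnEdge g i π) (hh : ActsOnEdge h i ρ) : ActsOnEdge (g * h) i (π * ρ) :=
  ⟨hg.1.mul hh.1, by simpa [mul_assoc] using hg.2.mul hh.2⟩

theorem inv (hg : ActsOnEdge g i π) : ActsOnEdge g⁻¹ i π⁻¹ :=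
  ⟨hg.1.inv, by simpa [mul_assoc] using hg.2.inv⟩

theorem turns {a : Fin 3} {A : Finset (Fin n)} {m : Fin 3 → Bool → Bool}
    (hm : ∀ s b, m s b = true ↔ coord i 0 s b ∈ A) :
    ActsOnEdge (turns a A) i (Label.turn a m) := by
  refine ⟨ActsAs.turns hm, ?_⟩
  let m' : Fin 3 → Bool → Bool := fun s b => decide (coord 0 i s b ∈ A)
  rw [← Label.turn_reface a m m']
  · exact ActsAs.turns (by simp [m'])
  · intro b
    rw [Bool.eq_iff_iff, hm, decide_eq_true_iff]
    simp [coord]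
  · intro b
    rw [Bool.eq_iff_iff, hm, decide_eq_true_iff]
    simp [coord]
  · intro b
    rw [Bool.eq_iff_iff, hm, decide_eq_true_iff]
    simp [coord]
  · intro b
    rw [Bool.eq_iff_iff, hm, hm]
    simp [coord]

end ActsOnEdge

theorem exists_actsOnEdge {g : Equiv.Perm (Facelet n)} {k : ℕ} (hg : Cost g k) (i : Fin n) :
    ∃ π, ActsOnEdge g i π := by
  refine hg.induction (p := fun g => ∃ π, ActsOnEdge g i π) ⟨1, ActsOnEdge.one⟩ ?_ ?_ ?_
  · rintro x y ⟨π, hπ⟩ ⟨ρ, hρ⟩; exact ⟨_, hπ.mul hρ⟩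
  · rintro x ⟨π, hπ⟩; exact ⟨_, hπ.inv⟩
  · intro a x
    rw [← turns_singleton]
    exact ⟨_, ActsOnEdge.turns (m := fun s b => decide (coord i 0 s b ∈ ({x} : Finset (Fin n))))
      (by simp)⟩

/-- The reference cells: both coordinates are near ones, and the first is central only if the
second is. -/
def Dom (i j : Fin n) : Prop := i ≤ i.rev ∧ j ≤ j.rev ∧ (i = i.rev → j = j.rev)

/-- Reflect both in-face coordinates to the near side; the parity of the three signs then decides
which one is called `i`. If a coordinate is central its sign is free, and is chosen so that the
order required by `Dom` results. -/
theorem exists_place_eq (s : Facelet n) : ∃ i j l, Dom i j ∧ place i j l = s := by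
  obtain ⟨p, ⟨f, b⟩, hv⟩ := s
  obtain ⟨x, y, d, e, hx, hy, hpx, hpy, h₁, h₂⟩ : ∃ (x y : Fin n) (d e : Bool),
      x ≤ x.rev ∧ y ≤ y.rev ∧ p (f + 1) = (if d then x.rev else x) ∧
      p (f + 2) = (if e then y.rev else y) ∧
      (xor b (xor d e) = true → x = x.rev → y = y.rev) ∧
      (xor b (xor d e) = false → y = y.rev → x = x.rev) := by
    obtain ⟨x, d, hx, hpx⟩ := exists_near_coord (p (f + 1))
    obtain ⟨y, e, hy, hpy⟩ := exists_near_coord (p (f + 2))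
    by_cases hx' : x = x.rev
    · by_cases hy' : y = y.rev
      · exact ⟨x, y, d, e, hx, hy, hpx, hpy, fun _ _ => hy', fun _ _ => hx'⟩
      · refine ⟨x, y, xor b e, e, hx, hy, ?_, hpy, ?_, fun _ h => absurd h hy'⟩
        · rw [hpx]; simp [← hx']
        · cases b <;> cases e <;> simp
    · by_cases hy' : y = y.rev
      · refine ⟨x, y, d, !(xor b d), hx, hy, hpx, ?_, fun _ h => absurd h hx', ?_⟩
        · rw [hpy]; simp [← hy']
        · cases b <;> cases d <;> simp
      · exact ⟨x, y, d, e, hx, hy, hpx, hpy, fun _ h => absurd h hx', fun _ h => absurd h hy'⟩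
  have hl : ∀ (f : Fin 3) (b d e : Bool), ∃ l : Label, l.1 = f ∧ l.sign f = b ∧
      l.sign (f + 1) = d ∧ l.sign (f + 2) = e ∧ l.sym f = 0 ∧
      l.sym (f + 1) = (if xor b (xor d e) then 1 else 2) ∧
      l.sym (f + 2) = (if xor b (xor d e) then 2 else 1) := by decide
  obtain ⟨l, hf, s₀, s₁, s₂, y₀, y₁, y₂⟩ := hl f b d e
  have hp : p f = if b then Fin.rev 0 else 0 := by
    have := Nat.pos_of_neZero n
    cases b
    · simpa [Visible] using hv
    · simp only [Visible, if_true] at hv ⊢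
      ext
      simp only [Fin.val_rev, Fin.val_zero]
      omega
  have hc : ∀ f c : Fin 3, c = f ∨ c = f + 1 ∨ c = f + 2 := by decide
  cases hχ : xor b (xor d e)
  · refine ⟨y, x, l, ⟨hy, hx, h₂ hχ⟩, Facelet.ext ?_ (by simp [place, hf, s₀])⟩
    funext c
    rcases hc f c with rfl | rfl | rfl
    · simp [place, s₀, y₀, coord, hp]
    · simp [place, s₁, y₁, coord, hpx, hχ]
    · simp [place, s₂, y₂, coord, hpy, hχ]
  · refine ⟨x, y, l, ⟨hx, hy, h₁ hχ⟩, Facelet.ext ?_ (by simp [place, hf, s₀])⟩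
    funext c
    rcases hc f c with rfl | rfl | rfl
    · simp [place, s₀, y₀, coord, hp]
    · simp [place, s₁, y₁, coord, hpx, hχ]
    · simp [place, s₂, y₂, coord, hpy, hχ]

/-- The commutator that cycles the cells in `I × J`. -/
def cellComm (I J : Finset (Fin n)) : Equiv.Perm (Facelet n) :=
  let P := turns 0 I
  let Q := (turns 2 {Fin.rev 0})⁻¹ * turns 0 (J.map Fin.revPerm.toEmbedding) * turns 2 {Fin.rev 0}
  P * Q * P⁻¹ * Q⁻¹

theorem Cost.cellComm (I J : Finset (Fin n)) :
    Cost (cellComm I J) (2 * (I.card + J.card) + 4) := by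
  have hP := Cost.turns 0 I
  have hU := Cost.turns 2 {(Fin.rev 0 : Fin n)}
  have hJ := Cost.turns 0 (J.map Fin.revPerm.toEmbedding)
  have hQ := (hU.inv.mul hJ).mul hU
  refine (((hP.mul hQ).mul hP.inv).mul hQ.inv).mono ?_
  simp
  omega

/-- The slices that may be turned in the first factor of a commutator. -/
def nearIndices (n : ℕ) [NeZero n] : Finset (Fin n) := {i | 0 < i ∧ i < i.rev}

theorem mem_nearIndices {i : Fin n} : i ∈ nearIndices n ↔ 0 < i ∧ i < i.rev := by
  simp [nearIndices]

theorem zero_ne_rev_zero (hn : 2 ≤ n) : (0 : Fin n) ≠ Fin.rev 0 := by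
  intro h
  have := congrArg Fin.val h
  rw [Fin.val_rev] at this
  simp at this
  omega

theorem Dom.edge_left {e : Fin n} (he : e ∈ nearIndices n) : Dom e 0 :=
  ⟨(mem_nearIndices.1 he).2.le, Fin.zero_le _, fun h => absurd h (mem_nearIndices.1 he).2.ne⟩

theorem Dom.edge_right (hn : 2 ≤ n) {e : Fin n} (he : e ∈ nearIndices n) : Dom 0 e :=
  ⟨Fin.zero_le _, (mem_nearIndices.1 he).2.le, fun h => absurd h (zero_ne_rev_zero hn)⟩

theorem rev_notMem_of_le_rev {I : Finset (Fin n)} (hI : I ⊆ nearIndices n) {v : Fin n}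
    (hv : v ≤ v.rev) : v.rev ∉ I := fun h => by
  have := (mem_nearIndices.1 (hI h)).2
  simp only [Fin.rev_rev] at this
  exact absurd hv (not_le.2 this)

theorem zero_notMem_nearIndices : (0 : Fin n) ∉ nearIndices n :=
  fun h => lt_irrefl _ (mem_nearIndices.1 h).1

theorem ActsAs.nearTurns {I : Finset (Fin n)} (hI : I ⊆ nearIndices n) {i j : Fin n}
    (hi : i ≤ i.rev) (hj : j ≤ j.rev) :
    ActsAs (RubiksCube.turns 0 I) i j
      (Label.nearTurn ![false, decide (i ∈ I), decide (j ∈ I)]) := by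
  have zero : (0 : Fin n) ∉ I := fun h => zero_notMem_nearIndices (hI h)
  refine ActsAs.turns fun s b => ?_
  fin_cases s <;> cases b <;>
    simp [coord, rev_notMem_of_le_rev hI, zero, hi, hj]

/-- Translates membership of the coordinates in `I`, `J`, the central slice and the extreme slice
into the Boolean parameters of `Label.comm`. -/
theorem ActsAs.cellComm (hn : 2 ≤ n) {I J : Finset (Fin n)} (hI : I ⊆ nearIndices n)
    (hJ : ∀ j ∈ J, j ≤ j.rev) {i j : Fin n} (hij : Dom i j) :
    ActsAs (RubiksCube.cellComm I J) i j (Label.comm ![false, decide (i ∈ I), decide (j ∈ I)]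
      ![decide (0 ∈ J), decide (i ∈ J), decide (j ∈ J)]
      ![false, decide (i = i.rev), decide (j = j.rev)] ![true, decide (i = 0), decide (j = 0)]) := by
  obtain ⟨hi, hj, -⟩ := hij
  have h0 : (0 : Fin n) < Fin.rev 0 := lt_of_le_of_ne (Fin.zero_le _) (zero_ne_rev_zero hn)
  have far : ∀ {v : Fin n}, v ≤ v.rev → (v.rev ∈ J ↔ v ∈ J ∧ v = v.rev) := fun {v} hv => by
    constructor
    · intro h
      have h1 := hJ _ h
      rw [Fin.rev_rev] at h1
      have := le_antisymm hv h1
      exact ⟨this ▸ h, this⟩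
    · rintro ⟨h, h'⟩; exact h' ▸ h
  have top : ∀ {v : Fin n}, v ≤ v.rev → v ≠ Fin.rev 0 := by
    rintro _ hv rfl
    rw [Fin.rev_rev] at hv
    exact absurd hv (not_le.2 h0)
  have hP := ActsAs.nearTurns hI hi hj
  have hU : ActsAs (RubiksCube.turns 2 {Fin.rev 0}) i j
      (Label.topTurn ![true, decide (i = 0), decide (j = 0)]) := by
    refine ActsAs.turns fun s b => ?_
    fin_cases s <;> cases b <;> simp [coord, top hi, top hj, top h0.le]
  have hQ : ActsAs (RubiksCube.turns 0 (J.map Fin.revPerm.toEmbedding)) i j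
      (Label.farTurn ![decide (0 ∈ J), decide (i ∈ J), decide (j ∈ J)]
        ![false, decide (i = i.rev), decide (j = j.rev)]) := by
    refine ActsAs.turns fun s b => ?_
    fin_cases s <;> cases b <;>
      simp [coord, Finset.mem_map_equiv, far hi, far hj, far h0.le, h0.ne]
  exact ((hP.mul ((hU.inv.mul hQ).mul hU)).mul hP.inv).mul ((hU.inv.mul hQ).mul hU).inv

end Place


/-! ### Three-cycles on rectangles and on arbitrary sets of interior cells -/

section Commutators

variable {n : ℕ} [NeZero n]

theorem rot_pow_four (a : Fin 3) : (rot a : Equiv.Perm (Facelet n)) ^ 4 = 1 := by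
  ext1 s
  obtain ⟨i, j, l, -, rfl⟩ := exists_place_eq s
  have : ∀ (a : Fin 3) (l : Label), Label.rot a (Label.rot a (Label.rot a (Label.rot a l))) = l := by
    decide
  simp only [pow_succ, pow_zero, one_mul, Equiv.Perm.mul_apply, rot_place, this,
    Equiv.Perm.one_apply]

theorem cost_conj_rot_iff {g : Equiv.Perm (Facelet n)} {k : ℕ} (a : Fin 3) :
    Cost (rot a * g * (rot a)⁻¹) k ↔ Cost g k := by
  refine ⟨fun h => ?_, fun h => h.conj_rot a⟩
  -- Three further conjugations undo the first, since a quarter turn has order dividing four.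
  have h3 := ((h.conj_rot a).conj_rot a).conj_rot a
  have e : rot a * (rot a * (rot a * (rot a * g * (rot a)⁻¹) * (rot a)⁻¹) * (rot a)⁻¹) * (rot a)⁻¹
      = rot a ^ 4 * g * (rot a ^ 4)⁻¹ := by simp only [pow_succ, pow_zero, one_mul, mul_inv_rev, mul_assoc]
  rw [e, rot_pow_four] at h3
  simpa using h3

/-- Rotations of the labels are induced by rotations of the whole cube, conjugation with which
preserves the number of moves. -/
theorem exists_rotation {σ : Equiv.Perm Label} (hσ : σ ∈ Label.rotations) :
    ∃ r : Equiv.Perm (Facelet n), (∀ i j, ActsAs r i j σ) ∧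
      ∀ g k, Cost (r * g * r⁻¹) k ↔ Cost g k := by
  induction hσ using Subgroup.closure_induction with
  | mem x hx =>
    obtain ⟨a, rfl⟩ := hx
    exact ⟨rot a, fun i j => ActsAs.rot a, fun g k => cost_conj_rot_iff a⟩
  | one => exact ⟨1, fun i j => ActsAs.one, fun g k => by simp⟩
  | mul x y _ _ hx hy =>
    obtain ⟨r, hr, hr'⟩ := hx
    obtain ⟨q, hq, hq'⟩ := hy
    refine ⟨r * q, fun i j => (hr i j).mul (hq i j), fun g k => ?_⟩
    rw [← hq' g k, ← hr' (q * g * q⁻¹) k]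
    simp [mul_assoc]
  | inv x _ hx =>
    obtain ⟨r, hr, hr'⟩ := hx
    refine ⟨r⁻¹, fun i j => (hr i j).inv, fun g k => ?_⟩
    rw [← hr']
    simp [mul_assoc]

/-- The second coordinates of interior reference cells. -/
def innerIndices (n : ℕ) [NeZero n] : Finset (Fin n) := {j | 0 < j ∧ j ≤ j.rev}

theorem mem_innerIndices {j : Fin n} : j ∈ innerIndices n ↔ 0 < j ∧ j ≤ j.rev := by
  simp [innerIndices]

theorem ActsAs.cellComm_interior (hn : 2 ≤ n) {I J : Finset (Fin n)} (hI : I ⊆ nearIndices n)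
    (hJ : J ⊆ innerIndices n) {i j : Fin n} (hij : Dom i j) :
    ActsAs (RubiksCube.cellComm I J) i j (if i ∈ I ∧ j ∈ J then Label.cycle else 1) := by
  have h := ActsAs.cellComm hn hI (fun j hj => (mem_innerIndices.1 (hJ hj)).2) hij
  have h0 : (0 : Fin n) ∉ J := fun h => lt_irrefl _ (mem_innerIndices.1 (hJ h)).1
  have h0' := zero_ne_rev_zero hn
  have hp : ∀ i : Fin n, i ∈ I → i ≠ i.rev ∧ i ≠ 0 := fun i hi =>
    ⟨(mem_nearIndices.1 (hI hi)).2.ne, (mem_nearIndices.1 (hI hi)).1.ne'⟩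
  rw [decide_eq_false h0, Label.comm_interior] at h
  · simpa using h
  · simpa using hp i
  · simpa using hp j
  · simp only [decide_eq_true_eq]; rintro rfl; simpa using ⟨h0', h0⟩
  · simp only [decide_eq_true_eq]; rintro rfl; simpa using ⟨h0', h0⟩
  · simpa using hij.2.2

theorem ActsAs.cellComm_edge (hn : 2 ≤ n) {e : Fin n} (he : e ∈ nearIndices n) {i j : Fin n}
    (hij : Dom i j) :
    ActsAs (RubiksCube.cellComm {e} {0}) i j (if i = e ∧ j = 0 then Label.cycle else
      if i = 0 ∧ j = e then Label.reface * Label.cycle * Label.reface⁻¹ else 1) := by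
  have h := ActsAs.cellComm hn (I := {e}) (J := {0}) (by simpa using he)
    (by simp) hij
  have h0' := zero_ne_rev_zero hn
  have hp : e ≠ e.rev ∧ e ≠ 0 := ⟨(mem_nearIndices.1 he).2.ne, (mem_nearIndices.1 he).1.ne'⟩
  simp only [Finset.mem_singleton, decide_true] at h
  rw [Label.comm_edge] at h
  · simpa using h
  · simp only [decide_eq_true_eq]; rintro rfl; simpa using hp
  · simp only [decide_eq_true_eq]; rintro rfl; simpa using hp
  · simp only [decide_eq_true_eq]; rintro rfl; simpa using h0'
  · simp only [decide_eq_true_eq]; rintro rfl; simpa using h0'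
  · simpa using hij.2.2

theorem exists_rectangle (hn : 2 ≤ n) {t : Equiv.Perm Label} (ht : t ∈ Label.cycles)
    {I J : Finset (Fin n)} (hI : I ⊆ nearIndices n) (hJ : J ⊆ innerIndices n) :
    ∃ w : Equiv.Perm (Facelet n), Cost w (2 * (I.card + J.card) + 4) ∧
      ∀ i j, Dom i j → ActsAs w i j (if i ∈ I ∧ j ∈ J then t else 1) := by
  obtain ⟨σ, hσ, rfl⟩ := ht
  obtain ⟨r, hr, hr'⟩ := exists_rotation (n := n) hσ
  refine ⟨r * cellComm I J * r⁻¹, (hr' _ _).2 (Cost.cellComm I J), fun i j hij => ?_⟩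
  have := ((hr i j).mul (ActsAs.cellComm_interior hn hI hJ hij)).mul (hr i j).inv
  split_ifs at this ⊢
  · exact this
  · simpa using this

/-- By disjointness at most one factor acts nontrivially on a given orbit, so `t` is never applied
twice. -/
theorem exists_rectangles (hn : 2 ≤ n) {t : Equiv.Perm Label} (ht : t ∈ Label.cycles)
    {ι : Type*} [DecidableEq ι] (R : Finset ι) (I J : ι → Finset (Fin n))
    (hI : ∀ r ∈ R, I r ⊆ nearIndices n) (hJ : ∀ r ∈ R, J r ⊆ innerIndices n)
    (hdis : ∀ r ∈ R, ∀ r' ∈ R, ∀ i j, i ∈ I r → j ∈ J r → i ∈ I r' → j ∈ J r' → r = r') :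
    ∃ w : Equiv.Perm (Facelet n), Cost w (∑ r ∈ R, (2 * ((I r).card + (J r).card) + 4)) ∧
      ∀ i j, Dom i j → ActsAs w i j (if ∃ r ∈ R, i ∈ I r ∧ j ∈ J r then t else 1) := by
  induction R using Finset.induction_on with
  | empty => exact ⟨1, Cost.one _, fun i j _ => by simpa using ActsAs.one⟩
  | insert r R hr ih =>
    obtain ⟨w, hw, hw'⟩ := ih (fun r hr => hI r (Finset.mem_insert_of_mem hr))
      (fun r hr => hJ r (Finset.mem_insert_of_mem hr))
      (fun r hr r' hr' => hdis r (Finset.mem_insert_of_mem hr) r' (Finset.mem_insert_of_mem hr'))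
    obtain ⟨v, hv, hv'⟩ := exists_rectangle hn ht (hI r (Finset.mem_insert_self _ _))
      (hJ r (Finset.mem_insert_self _ _))
    refine ⟨v * w, ?_, fun i j hij => ?_⟩
    · rw [Finset.sum_insert hr]; exact hv.mul hw
    · have h := (hv' i j hij).mul (hw' i j hij)
      by_cases h1 : i ∈ I r ∧ j ∈ J r
      · have h2 : ¬ ∃ r ∈ R, i ∈ I r ∧ j ∈ J r := by
          rintro ⟨r', hr', hi, hj⟩
          have := hdis r (Finset.mem_insert_self _ _) r' (Finset.mem_insert_of_mem hr') i j
            h1.1 h1.2 hi hj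
          exact hr (this ▸ hr')
        simpa [h1, h2] using h
      · simpa [h1] using h

/-- The number of moves used to treat an arbitrary set of cells, when the columns are divided in
blocks of size `b`. -/
def blockBound (n b : ℕ) : ℕ := (n / b + 1) * (2 * n + 2 ^ b * (2 * b + 4))

/-- The saving step: an arbitrary set of cells is a disjoint union of rectangles indexed by a block
`k` and a subset `T` of it, the rows being those whose trace on the block is exactly `T`. In one
block the row sets are disjoint, so they contribute `2 * n` in total, while the at most `2 ^ b`
subsets contribute `2 * b + 4` each. -/
theorem exists_set (hn : 2 ≤ n) {t : Equiv.Perm Label} (ht : t ∈ Label.cycles) {b : ℕ}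
    (hb : 0 < b) (S : Fin n → Fin n → Prop) [∀ i j, Decidable (S i j)] :
    ∃ w : Equiv.Perm (Facelet n), Cost w (blockBound n b) ∧ ∀ i j, Dom i j →
      ActsAs w i j (if i ∈ nearIndices n ∧ j ∈ innerIndices n ∧ S i j then t else 1) := by
  let block : ℕ → Finset (Fin n) := fun k => (innerIndices n).filter fun j => (j : ℕ) / b = k
  let R : Finset (Σ _ : ℕ, Finset (Fin n)) :=
    (Finset.range (n / b + 1)).sigma fun k => (block k).powerset
  let I : (Σ _ : ℕ, Finset (Fin n)) → Finset (Fin n) := fun r =>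
    (nearIndices n).filter fun i => (block r.1).filter (S i) = r.2
  let J : (Σ _ : ℕ, Finset (Fin n)) → Finset (Fin n) := fun r => r.2
  have hJb : ∀ r ∈ R, J r ⊆ block r.1 := fun r hr =>
    Finset.mem_powerset.1 (Finset.mem_sigma.1 hr).2
  obtain ⟨w, hw, hw'⟩ := exists_rectangles hn ht R I J (fun r _ => Finset.filter_subset _ _)
    (fun r hr => (hJb r hr).trans (Finset.filter_subset _ _)) (by
      rintro ⟨k, T⟩ hr ⟨k', T'⟩ hr' i j hi hj hi' hj'
      have e1 := (Finset.mem_filter.1 (hJb _ hr hj)).2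
      have e2 := (Finset.mem_filter.1 (hJb _ hr' hj')).2
      simp only at e1 e2
      obtain rfl : k = k' := e1.symm.trans e2
      have e3 := (Finset.mem_filter.1 hi).2
      have e4 := (Finset.mem_filter.1 hi').2
      simp only at e3 e4
      rw [← e3, ← e4])
  refine ⟨w, hw.mono ?_, fun i j hij => ?_⟩
  · have hcard : ∀ k, (block k).card ≤ b := fun k => by
      rw [← Finset.card_range b]
      -- Within a block the quotient by `b` is fixed, so the remainder determines the column.
      refine Finset.card_le_card_of_injOn (fun j => (j : ℕ) % b) (fun j _ => ?_) ?_
      · simpa using Nat.mod_lt _ hb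
      · intro x hx y hy hxy
        have hx := (Finset.mem_filter.1 hx).2
        have hy := (Finset.mem_filter.1 hy).2
        simp only at hxy
        ext
        rw [← Nat.div_add_mod (x : ℕ) b, ← Nat.div_add_mod (y : ℕ) b, hx, hy, hxy]
    rw [Finset.sum_sigma, blockBound]
    refine (Finset.sum_le_card_nsmul _ _ (2 * n + 2 ^ b * (2 * b + 4)) fun k _ => ?_).trans
      (by simp)
    have h1 : ∑ T ∈ (block k).powerset, (I ⟨k, T⟩).card ≤ n := by
      have := Finset.card_eq_sum_card_fiberwise (s := nearIndices n) (t := (block k).powerset)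
        (f := fun i => (block k).filter (S i))
        (fun i _ => Finset.mem_powerset.2 (Finset.filter_subset _ _))
      refine this.symm.trans_le ((Finset.card_le_univ _).trans (by simp))
    have h2 : ∑ T ∈ (block k).powerset, (2 * T.card + 4) ≤ 2 ^ b * (2 * b + 4) := by
      refine (Finset.sum_le_card_nsmul _ _ (2 * b + 4) fun T hT => ?_).trans ?_
      · have := (Finset.card_le_card (Finset.mem_powerset.1 hT)).trans (hcard k)
        omega
      · rw [Finset.card_powerset, smul_eq_mul]
        exact Nat.mul_le_mul_right _ (Nat.pow_le_pow_right (by norm_num) (hcard k))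
    calc _ = 2 * ∑ T ∈ (block k).powerset, (I ⟨k, T⟩).card +
          ∑ T ∈ (block k).powerset, (2 * T.card + 4) := by
          rw [Finset.mul_sum, ← Finset.sum_add_distrib]
          exact Finset.sum_congr rfl fun T _ => by simp only [J]; ring
      _ ≤ _ := by omega
  · have h := hw' i j hij
    have hiff : (∃ r ∈ R, i ∈ I r ∧ j ∈ J r) ↔
        i ∈ nearIndices n ∧ j ∈ innerIndices n ∧ S i j := by
      constructor
      · rintro ⟨⟨k, T⟩, hr, hi, hj⟩
        obtain ⟨hi, hT⟩ := Finset.mem_filter.1 hi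
        simp only at hT
        have hj' : j ∈ T := hj
        rw [← hT, Finset.mem_filter] at hj'
        exact ⟨hi, (Finset.mem_filter.1 hj'.1).1, hj'.2⟩
      · rintro ⟨hi, hj, hS⟩
        refine ⟨⟨(j : ℕ) / b, (block ((j : ℕ) / b)).filter (S i)⟩, ?_, ?_, ?_⟩
        · simp only [R, Finset.mem_sigma, Finset.mem_range, Finset.mem_powerset]
          exact ⟨Nat.lt_succ_of_le (Nat.div_le_div_right j.2.le), Finset.filter_subset _ _⟩
        · simp [I, hi]
        · simp [J, block, hj, hS]
    simpa only [hiff] using h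

end Commutators


/-- Any even permutation of labels can be performed in all orbits of a set of interior cells. -/
theorem exists_set_of_even {α : Equiv.Perm Label} (hα : α ∈ alternatingGroup Label) :
    ∃ K : ℕ, ∀ (n : ℕ) [NeZero n], 2 ≤ n → ∀ b : ℕ, 0 < b →
      ∀ (S : Fin n → Fin n → Prop) [∀ i j, Decidable (S i j)],
      ∃ w : Equiv.Perm (Facelet n), Cost w (K * blockBound n b) ∧ ∀ i j, Dom i j →
        ActsAs w i j (if i ∈ nearIndices n ∧ j ∈ innerIndices n ∧ S i j then α else 1) := by
  rw [← Label.closure_cycles] at hα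
  induction hα using Subgroup.closure_induction with
  | mem t ht =>
    refine ⟨1, fun n _ hn b hb S _ => ?_⟩
    simpa using exists_set hn ht hb S
  | one => exact ⟨0, fun n _ hn b hb S _ => ⟨1, Cost.one _, fun i j _ => by simpa using ActsAs.one⟩⟩
  | mul x y _ _ hx hy =>
    obtain ⟨K, hK⟩ := hx
    obtain ⟨M, hM⟩ := hy
    refine ⟨K + M, fun n _ hn b hb S _ => ?_⟩
    obtain ⟨v, hv, hv'⟩ := hK n hn b hb S
    obtain ⟨w, hw, hw'⟩ := hM n hn b hb S
    refine ⟨v * w, by rw [add_mul]; exact hv.mul hw, fun i j hij => ?_⟩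
    have := (hv' i j hij).mul (hw' i j hij)
    split_ifs at this ⊢
    · exact this
    · simpa using this
  | inv x _ hx =>
    obtain ⟨K, hK⟩ := hx
    refine ⟨K, fun n _ hn b hb S _ => ?_⟩
    obtain ⟨v, hv, hv'⟩ := hK n hn b hb S
    refine ⟨v⁻¹, hv.inv, fun i j hij => ?_⟩
    have := (hv' i j hij).inv
    split_ifs at this ⊢
    · exact this
    · simpa using this

/-- Arbitrary even permutations can be performed simultaneously in all interior orbits. -/
theorem exists_interior :
    ∃ K : ℕ, ∀ (n : ℕ) [NeZero n], 2 ≤ n → ∀ b : ℕ, 0 < b →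
      ∀ α : Fin n → Fin n → Equiv.Perm Label, (∀ i j, α i j ∈ alternatingGroup Label) →
      ∃ w : Equiv.Perm (Facelet n), Cost w (K * blockBound n b) ∧ ∀ i j, Dom i j →
        ActsAs w i j (if i ∈ nearIndices n ∧ j ∈ innerIndices n then α i j else 1) := by
  suffices h : ∀ A : Finset (Equiv.Perm Label), (∀ x ∈ A, x ∈ alternatingGroup Label) →
      ∃ K : ℕ, ∀ (n : ℕ) [NeZero n], 2 ≤ n → ∀ b : ℕ, 0 < b →
      ∀ α : Fin n → Fin n → Equiv.Perm Label,
      ∃ w : Equiv.Perm (Facelet n), Cost w (K * blockBound n b) ∧ ∀ i j, Dom i j →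
        ActsAs w i j
          (if i ∈ nearIndices n ∧ j ∈ innerIndices n ∧ α i j ∈ A then α i j else 1) by
    -- There are finitely many even permutations; one round treats all cells where a given one is
    -- prescribed, so the number of rounds is independent of `n`.
    obtain ⟨K, hK⟩ := h (Finset.univ.filter fun x => Equiv.Perm.sign x = 1)
      (by simp)
    refine ⟨K, fun n _ hn b hb α hα => ?_⟩
    have hα' : ∀ i j, Equiv.Perm.sign (α i j) = 1 := hα
    simpa [hα'] using hK n hn b hb α
  intro A
  induction A using Finset.induction_on with
  | empty =>
    exact fun _ => ⟨0, fun n _ hn b hb α => ⟨1, Cost.one _, fun i j _ => by simpa using ActsAs.one⟩⟩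
  | insert x A hx ih =>
    intro hA
    obtain ⟨K, hK⟩ := ih fun y hy => hA y (Finset.mem_insert_of_mem hy)
    obtain ⟨M, hM⟩ := exists_set_of_even (hA x (Finset.mem_insert_self _ _))
    refine ⟨K + M, fun n _ hn b hb α => ?_⟩
    obtain ⟨v, hv, hv'⟩ := hK n hn b hb α
    obtain ⟨w, hw, hw'⟩ := hM n hn b hb fun i j => α i j = x
    refine ⟨v * w, by rw [add_mul]; exact hv.mul hw, fun i j hij => ?_⟩
    have h := (hv' i j hij).mul (hw' i j hij)
    by_cases h1 : i ∈ nearIndices n ∧ j ∈ innerIndices n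
    · by_cases h2 : α i j = x
      · subst h2
        simpa [h1, hx] using h
      · simpa [h1, h2] using h
    · have e1 : ∀ q : Prop, ¬ (i ∈ nearIndices n ∧ j ∈ innerIndices n ∧ q) := fun q h =>
        h1 ⟨h.1, h.2.1⟩
      simpa [e1] using h

/-! ### Edge orbits -/

theorem Label.reface_mul {σ : Equiv.Perm Label} (hσ : σ ∈ Label.rotations) :
    Label.reface * σ = σ * Label.reface := by
  induction hσ using Subgroup.closure_induction with
  | mem x hx =>
    obtain ⟨a, rfl⟩ := hx
    revert a
    decide
  | one => simp
  | mul x y _ _ hx hy => rw [← mul_assoc, hx, mul_assoc, hy, mul_assoc]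
  | inv x _ hx => rw [eq_inv_mul_iff_mul_eq, ← mul_assoc, ← hx, mul_assoc, mul_inv_cancel, mul_one]

/-- `w` acts as `α` on the edge orbit `e`, and trivially on all other corners and edges and on the
face centres. -/
def SolvesEdge {n : ℕ} [NeZero n] (w : Equiv.Perm (Facelet n)) (e : Fin n)
    (α : Equiv.Perm Label) : Prop :=
  ActsOnEdge w e α ∧ ∀ i j, Dom i j → ¬ (i ∈ nearIndices n ∧ j ∈ innerIndices n) →
    ¬ (i = e ∧ j = 0) → ¬ (i = 0 ∧ j = e) → ActsAs w i j 1

namespace SolvesEdge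

variable {n : ℕ} [NeZero n] {v w : Equiv.Perm (Facelet n)} {e : Fin n} {α β : Equiv.Perm Label}

theorem one : SolvesEdge 1 e 1 := ⟨ActsOnEdge.one, fun _ _ _ _ _ _ => ActsAs.one⟩

theorem mul (hv : SolvesEdge v e α) (hw : SolvesEdge w e β) : SolvesEdge (v * w) e (α * β) :=
  ⟨hv.1.mul hw.1, fun i j h h₁ h₂ h₃ => by
    simpa using (hv.2 i j h h₁ h₂ h₃).mul (hw.2 i j h h₁ h₂ h₃)⟩

theorem inv (hv : SolvesEdge v e α) : SolvesEdge v⁻¹ e α⁻¹ :=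
  ⟨hv.1.inv, fun i j h h₁ h₂ h₃ => by simpa using (hv.2 i j h h₁ h₂ h₃).inv⟩

/-- The slice meets, outside the interior orbits, only the edge orbit `e`. `SolvesEdge` leaves
interior orbits unconstrained, as they are repaired later. -/
theorem sliceTurn (he : e ∈ nearIndices n) : SolvesEdge (sliceTurn 0 e) e Label.sliceOne := by
  have hsub : ({e} : Finset (Fin n)) ⊆ nearIndices n := by simpa using he
  have he' := mem_nearIndices.1 he
  rw [← turns_singleton]
  refine ⟨ActsOnEdge.turns fun s b => ?_, fun i j hij h₁ h₂ h₃ => ?_⟩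
  · have h1 : Fin.rev 0 ≠ e := fun h =>
      rev_notMem_of_le_rev hsub (v := (0 : Fin n)) (Fin.zero_le _) (by simp [h])
    have h2 : e.rev ≠ e := he'.2.ne'
    fin_cases s <;> cases b <;> simp [coord, h1, h2, he'.1.ne]
  · have h := ActsAs.nearTurns hsub hij.1 hij.2.1
    have hi : i ≠ e := by
      rintro rfl
      refine h₁ ⟨he, mem_innerIndices.2 ⟨?_, hij.2.1⟩⟩
      exact Fin.pos_iff_ne_zero.2 fun h => h₂ ⟨rfl, h⟩
    have hj : j ≠ e := by
      rintro rfl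
      have hi0 : i ≠ 0 := fun h => h₃ ⟨h, rfl⟩
      refine h₁ ⟨mem_nearIndices.2 ⟨Fin.pos_iff_ne_zero.2 hi0, lt_of_le_of_ne hij.1 fun h => ?_⟩,
        mem_innerIndices.2 ⟨he'.1, hij.2.1⟩⟩
      exact he'.2.ne (hij.2.2 h)
    have h1 : Label.nearTurn ![false, false, false] = 1 := by decide
    simpa [hi, hj, h1] using h

theorem cycles (hn : 2 ≤ n) (he : e ∈ nearIndices n) {t : Equiv.Perm Label}
    (ht : t ∈ Label.cycles) : ∃ w : Equiv.Perm (Facelet n), Cost w 8 ∧ SolvesEdge w e t := by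
  obtain ⟨σ, hσ, rfl⟩ := ht
  obtain ⟨r, hr, hr'⟩ := exists_rotation (n := n) hσ
  have he' := mem_nearIndices.1 he
  refine ⟨r * cellComm {e} {0} * r⁻¹, (hr' _ _).2 (Cost.cellComm {e} {0}), ⟨?_, ?_⟩, ?_⟩
  · have h := ActsAs.cellComm_edge hn he (Dom.edge_left he)
    rw [if_pos ⟨rfl, rfl⟩] at h
    exact ((hr _ _).mul h).mul (hr _ _).inv
  · have h := ActsAs.cellComm_edge hn he (Dom.edge_right hn he)
    rw [if_neg (fun h => he'.1.ne h.1), if_pos ⟨rfl, rfl⟩] at h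
    convert ((hr _ _).mul h).mul (hr _ _).inv using 1
    have hc := Label.reface_mul hσ
    have hc' : σ⁻¹ * Label.reface⁻¹ = Label.reface⁻¹ * σ⁻¹ := by
      rw [← mul_inv_rev, ← mul_inv_rev, hc]
    calc _ = (Label.reface * σ) * Label.cycle * (σ⁻¹ * Label.reface⁻¹) := by
          simp only [mul_assoc]
      _ = _ := by rw [hc, hc']; simp only [mul_assoc]
  · intro i j hij h₁ h₂ h₃
    have h := ActsAs.cellComm_edge hn he hij
    rw [if_neg h₂, if_neg h₃] at h
    simpa using ((hr _ _).mul h).mul (hr _ _).inv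

end SolvesEdge

theorem exists_solvesEdge_of_even {α : Equiv.Perm Label} (hα : α ∈ alternatingGroup Label) :
    ∃ K : ℕ, ∀ (n : ℕ) [NeZero n], 2 ≤ n → ∀ e ∈ nearIndices n,
      ∃ w : Equiv.Perm (Facelet n), Cost w K ∧ SolvesEdge w e α := by
  rw [← Label.closure_cycles] at hα
  induction hα using Subgroup.closure_induction with
  | mem t ht => exact ⟨8, fun n _ hn e he => SolvesEdge.cycles hn he ht⟩
  | one => exact ⟨0, fun n _ hn e he => ⟨1, Cost.one _, SolvesEdge.one⟩⟩
  | mul x y _ _ hx hy =>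
    obtain ⟨K, hK⟩ := hx
    obtain ⟨M, hM⟩ := hy
    refine ⟨K + M, fun n _ hn e he => ?_⟩
    obtain ⟨v, hv, hv'⟩ := hK n hn e he
    obtain ⟨w, hw, hw'⟩ := hM n hn e he
    exact ⟨v * w, hv.mul hw, hv'.mul hw'⟩
  | inv x _ hx =>
    obtain ⟨K, hK⟩ := hx
    refine ⟨K, fun n _ hn e he => ?_⟩
    obtain ⟨v, hv, hv'⟩ := hK n hn e he
    exact ⟨v⁻¹, hv.inv, hv'.inv⟩

/-- Any permutation of an edge orbit can be performed by a bounded number of moves. -/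
theorem exists_solvesEdge :
    ∃ K : ℕ, ∀ (n : ℕ) [NeZero n], 2 ≤ n → ∀ e ∈ nearIndices n, ∀ α : Equiv.Perm Label,
      ∃ w : Equiv.Perm (Facelet n), Cost w K ∧ SolvesEdge w e α := by
  have h : ∀ α : Equiv.Perm Label, ∃ K : ℕ, ∀ (n : ℕ) [NeZero n], 2 ≤ n → ∀ e ∈ nearIndices n,
      ∃ w : Equiv.Perm (Facelet n), Cost w K ∧ SolvesEdge w e α := by
    intro α
    rcases Int.units_eq_one_or (Equiv.Perm.sign α) with h | h
    · exact exists_solvesEdge_of_even h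
    -- One slice turn makes the remaining permutation even.
    · obtain ⟨K, hK⟩ := exists_solvesEdge_of_even (α := Label.sliceOne⁻¹ * α) (by
        rw [Equiv.Perm.mem_alternatingGroup, Equiv.Perm.sign_mul, Equiv.Perm.sign_inv,
          Label.sign_sliceOne, h]; rfl)
      refine ⟨1 + K, fun n _ hn e he => ?_⟩
      obtain ⟨w, hw, hw'⟩ := hK n hn e he
      refine ⟨sliceTurn 0 e * w, (Cost.sliceTurn 0 e).mul hw, ?_⟩
      simpa using (SolvesEdge.sliceTurn he).mul hw'
  choose K hK using h
  refine ⟨Finset.univ.sup K, fun n _ hn e he α => ?_⟩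
  obtain ⟨w, hw, hw'⟩ := hK α n hn e he
  exact ⟨w, hw.mono (Finset.le_sup (Finset.mem_univ α)), hw'⟩

/-- The corners, the middle edges and the face centres are fixed. -/
def FixesSpecial {n : ℕ} [NeZero n] (g : Equiv.Perm (Facelet n)) : Prop :=
  ∀ i j, Dom i j → i ∉ nearIndices n → j ∉ nearIndices n → ActsAs g i j 1

/-- Edge orbits are corrected one at a time: the repair of one disturbs neither the special cubies
nor the other edge orbits, so the total cost is linear in `n`. -/
theorem exists_edges :
    ∃ K : ℕ, ∀ (n : ℕ) [NeZero n], 2 ≤ n → ∀ (g : Equiv.Perm (Facelet n)) (k : ℕ), Cost g k →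
      FixesSpecial g → ∃ w : Equiv.Perm (Facelet n), Cost w (K * n) ∧ FixesSpecial (w * g) ∧
        ∀ e ∈ nearIndices n, ActsOnEdge (w * g) e 1 := by
  obtain ⟨K, hK⟩ := exists_solvesEdge
  refine ⟨K, fun n _ hn g k hg hspec => ?_⟩
  suffices h : ∀ T : Finset (Fin n), T ⊆ nearIndices n →
      ∃ w : Equiv.Perm (Facelet n), Cost w (K * T.card) ∧ FixesSpecial (w * g) ∧
        ∀ e ∈ T, ActsOnEdge (w * g) e 1 by
    obtain ⟨w, hw, h⟩ := h _ (Finset.Subset.refl _)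
    refine ⟨w, hw.mono (Nat.mul_le_mul_left _ ((Finset.card_le_univ _).trans (by simp))), h⟩
  intro T
  induction T using Finset.induction_on with
  | empty => exact fun _ => ⟨1, Cost.one _, by simpa using hspec, by simp⟩
  | insert e T heT ih =>
    intro hT
    obtain ⟨w, hw, hw₁, hw₂⟩ := ih fun x hx => hT (Finset.mem_insert_of_mem hx)
    have he := hT (Finset.mem_insert_self _ _)
    have he' := mem_nearIndices.1 he
    obtain ⟨π, hπ⟩ := exists_actsOnEdge (hw.mul hg) e
    obtain ⟨v, hv, hv₁, hv₂⟩ := hK n hn e he π⁻¹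
    refine ⟨v * w, ?_, ?_, ?_⟩
    · rw [Finset.card_insert_of_notMem heT, mul_add, mul_one, add_comm]
      exact hv.mul hw
    · intro i j hij hi hj
      rw [mul_assoc]
      refine (hv₂ i j hij (fun h => hi h.1) ?_ ?_).mul (hw₁ i j hij hi hj)
      · rintro ⟨rfl, -⟩; exact hi he
      · rintro ⟨-, rfl⟩; exact hj he
    · intro x hx
      rw [mul_assoc]
      by_cases hxe : x = e
      · subst hxe
        simpa using hv₁.mul hπ
      · have hxT : x ∈ T := Finset.mem_of_mem_insert_of_ne hx hxe
        have hx' := mem_nearIndices.1 (hT hx)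
        have h1 := hv₂ x 0 (Dom.edge_left (hT hx)) (fun h => lt_irrefl _ (mem_innerIndices.1 h.2).1)
          (fun h => hxe h.1) (fun h => hx'.1.ne' h.1)
        have h2 := hv₂ 0 x (Dom.edge_right hn (hT hx)) (fun h => zero_notMem_nearIndices h.1)
          (fun h => he'.1.ne h.1) (fun h => hxe h.2)
        have := (show ActsOnEdge v x 1 from ⟨h1, by simpa using h2⟩).mul (hw₂ x hxT)
        simpa using this


/-! ### Corners, middle edges and face centres as an embedded small cube -/

instance {n : ℕ} : Finite (Facelet n) :=
  Finite.of_injective (fun s : Facelet n => (s.pos, s.face)) fun _ _ h =>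
    Facelet.ext (congrArg Prod.fst h) (congrArg Prod.snd h)

/-- An embedding of indices that is compatible with reflection and with the boundary. -/
structure IndexEmb (k n : ℕ) where
  toFun : Fin k → Fin n
  inj : Function.Injective toFun
  map_rev : ∀ x, toFun x.rev = (toFun x).rev
  map_zero : ∀ x, (toFun x : ℕ) = 0 ↔ (x : ℕ) = 0

namespace IndexEmb

variable {k n : ℕ} (φ : IndexEmb k n)

theorem map_last (x : Fin k) : (φ.toFun x : ℕ) + 1 = n ↔ (x : ℕ) + 1 = k := by
  have h := φ.map_zero x.rev
  rw [φ.map_rev, Fin.val_rev, Fin.val_rev] at h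
  omega

theorem visible_iff (p : Position k) (f : Face) :
    Visible (fun c => φ.toFun (p c)) f ↔ Visible p f := by
  unfold Visible
  split
  · exact φ.map_last _
  · exact φ.map_zero _

/-- The facelets of the small cube as facelets of the large one. -/
def facelet (s : Facelet k) : Facelet n :=
  ⟨fun c => φ.toFun (s.pos c), s.face, (φ.visible_iff _ _).2 s.visible⟩

theorem facelet_rot (a : Fin 3) (s : Facelet k) : φ.facelet (rot a s) = rot a (φ.facelet s) := by
  refine Facelet.ext ?_ rfl
  funext j
  simp only [facelet, rot, Equiv.coe_fn_mk, rotPos]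
  split_ifs <;> simp [φ.map_rev]

theorem exists_facelet_eq (s : Facelet n) (h : ∀ c, ∃ x, φ.toFun x = s.pos c) :
    ∃ t, φ.facelet t = s := by
  choose q hq using h
  refine ⟨⟨q, s.face, (φ.visible_iff _ _).1 ?_⟩, Facelet.ext (funext hq) rfl⟩
  simp only [hq]
  exact s.visible

/-- `g` acts on the embedded small cube as `h`. -/
def Compat (h : Equiv.Perm (Facelet k)) (g : Equiv.Perm (Facelet n)) : Prop :=
  ∀ s, g (φ.facelet s) = φ.facelet (h s)

variable {φ}

theorem Compat.one : φ.Compat 1 1 := fun _ => rfl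

theorem Compat.mul {h h' : Equiv.Perm (Facelet k)} {g g' : Equiv.Perm (Facelet n)}
    (H : φ.Compat h g) (H' : φ.Compat h' g') : φ.Compat (h * h') (g * g') := fun s => by
  rw [Equiv.Perm.mul_apply, H', H, Equiv.Perm.mul_apply]

theorem Compat.inv {h : Equiv.Perm (Facelet k)} {g : Equiv.Perm (Facelet n)}
    (H : φ.Compat h g) : φ.Compat h⁻¹ g⁻¹ := fun s => by
  rw [Equiv.Perm.inv_eq_iff_eq, H]; simp

theorem Compat.sliceTurn (a : Fin 3) (x : Fin k) :
    φ.Compat (sliceTurn a x) (sliceTurn a (φ.toFun x)) := fun s => by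
  rw [sliceTurn_apply, sliceTurn_apply]
  have : (φ.facelet s).pos a = φ.toFun x ↔ s.pos a = x := φ.inj.eq_iff
  simp only [this]
  split
  · exact (φ.facelet_rot a s).symm
  · rfl

/-- A slice in the image of the embedding acts as a slice of the small cube; any other slice misses
the embedded cube and acts trivially. -/
theorem exists_compat_of_cost {g : Equiv.Perm (Facelet n)} {N : ℕ} (hg : Cost g N) :
    ∃ h, (∃ M, Cost h M) ∧ φ.Compat h g := by
  refine hg.induction (p := fun g => ∃ h, (∃ M, Cost h M) ∧ φ.Compat h g)
    ⟨1, ⟨0, Cost.one _⟩, Compat.one⟩ ?_ ?_ fun a i => ?_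
  · rintro x y ⟨h, ⟨M, hM⟩, H⟩ ⟨h', ⟨M', hM'⟩, H'⟩
    exact ⟨h * h', ⟨_, hM.mul hM'⟩, H.mul H'⟩
  · rintro x ⟨h, ⟨M, hM⟩, H⟩
    exact ⟨h⁻¹, ⟨M, hM.inv⟩, H.inv⟩
  · by_cases hi : ∃ x, φ.toFun x = i
    · obtain ⟨x, rfl⟩ := hi
      exact ⟨_, ⟨1, Cost.sliceTurn a x⟩, Compat.sliceTurn a x⟩
    · refine ⟨1, ⟨0, Cost.one _⟩, fun s => ?_⟩
      have hs : (φ.facelet s).pos a ≠ i := fun h => hi ⟨_, h⟩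
      rw [sliceTurn_apply, if_neg hs]
      rfl

theorem exists_cost_of_compat {h : Equiv.Perm (Facelet k)} {N : ℕ} (hh : Cost h N) :
    ∃ g, Cost g N ∧ φ.Compat h g := by
  refine hh.lift (r := φ.Compat) Compat.one (fun _ _ _ _ => Compat.mul) fun m => ?_
  refine ⟨⟨m.axis, φ.toFun m.index, m.positive⟩, ?_⟩
  unfold Move.perm
  split
  · exact Compat.sliceTurn _ _
  · exact (Compat.sliceTurn _ _).inv

end IndexEmb

/-- The embedded small cube can be restored by a bounded number of moves. -/
theorem exists_restore (k : ℕ) :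
    ∃ L : ℕ, ∀ (n : ℕ) (φ : IndexEmb k n) (g : Equiv.Perm (Facelet n)) (N : ℕ), Cost g N →
      ∃ w : Equiv.Perm (Facelet n), Cost w L ∧ ∀ s, (w * g) (φ.facelet s) = φ.facelet s := by
  -- The small cube has finitely many permutations, so the move counts `N` of the attainable ones
  -- have a maximum, independent of `n`; unattainable ones get the dummy value `0`.
  have : Fintype (Equiv.Perm (Facelet k)) := Fintype.ofFinite _
  have h : ∀ h : Equiv.Perm (Facelet k), ∃ N, (∃ M, Cost h M) → Cost h N := fun h => by
    by_cases hM : ∃ M, Cost h M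
    · obtain ⟨M, hM⟩ := hM
      exact ⟨M, fun _ => hM⟩
    · exact ⟨0, fun h => absurd h hM⟩
  choose N hN using h
  refine ⟨Finset.univ.sup N, fun n φ g M hg => ?_⟩
  obtain ⟨h, ⟨M', hh⟩, H⟩ := IndexEmb.exists_compat_of_cost (φ := φ) hg
  obtain ⟨w, hw, H'⟩ := IndexEmb.exists_cost_of_compat (φ := φ) (hN h⁻¹ ⟨M', hh.inv⟩)
  refine ⟨w, hw.mono (Finset.le_sup (Finset.mem_univ h⁻¹)), fun s => ?_⟩
  simpa using H'.mul H s

/-- The extreme indices, together with the central one for odd `n`, are closed under reflection;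
this gives size 2 or 3 according to parity. -/
theorem exists_indexEmb {n : ℕ} (hn : 2 ≤ n) : ∃ k, (k = 2 ∨ k = 3) ∧ ∃ φ : IndexEmb k n,
    ∀ v : Fin n, (v : ℕ) = 0 ∨ (v : ℕ) + 1 = n ∨ v = v.rev → ∃ x, φ.toFun x = v := by
  rcases Nat.even_or_odd' n with ⟨m, rfl | rfl⟩
  · refine ⟨2, Or.inl rfl, ⟨![⟨0, by omega⟩, ⟨2 * m - 1, by omega⟩], ?_, ?_, ?_⟩, ?_⟩
    · intro x y h
      fin_cases x <;> fin_cases y <;> simp at h ⊢ <;> omega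
    · intro x
      fin_cases x <;> simp [Fin.ext_iff, Fin.val_rev]
      omega
    · intro x
      fin_cases x <;> simp; omega
    · intro v hv
      rcases hv with h | h | h
      · exact ⟨0, Fin.ext (by simp [h])⟩
      · exact ⟨1, Fin.ext (by simp; omega)⟩
      · have := congrArg Fin.val h
        rw [Fin.val_rev] at this
        omega
  · refine ⟨3, Or.inr rfl, ⟨![⟨0, by omega⟩, ⟨m, by omega⟩, ⟨2 * m, by omega⟩], ?_, ?_, ?_⟩, ?_⟩
    · intro x y h
      fin_cases x <;> fin_cases y <;> simp at h ⊢ <;> omega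
    · intro x
      fin_cases x <;> simp [Fin.ext_iff, Fin.val_rev]
      omega
    · intro x
      fin_cases x <;> simp <;> omega
    · intro v hv
      rcases hv with h | h | h
      · exact ⟨0, Fin.ext (by simp [h])⟩
      · exact ⟨2, Fin.ext (by simp; omega)⟩
      · have := congrArg Fin.val h
        rw [Fin.val_rev] at this
        exact ⟨1, Fin.ext (by simp; omega)⟩

theorem exists_special :
    ∃ L : ℕ, ∀ (n : ℕ) [NeZero n], 2 ≤ n → ∀ (g : Equiv.Perm (Facelet n)) (N : ℕ), Cost g N →
      ∃ w : Equiv.Perm (Facelet n), Cost w L ∧ FixesSpecial (w * g) := by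
  obtain ⟨L₂, h₂⟩ := exists_restore 2
  obtain ⟨L₃, h₃⟩ := exists_restore 3
  refine ⟨max L₂ L₃, fun n _ hn g N hg => ?_⟩
  obtain ⟨k, hk, φ, hφ⟩ := exists_indexEmb hn
  obtain ⟨w, hw, hw'⟩ : ∃ w : Equiv.Perm (Facelet n), Cost w (max L₂ L₃) ∧
      ∀ s, (w * g) (φ.facelet s) = φ.facelet s := by
    rcases hk with rfl | rfl
    · obtain ⟨w, hw, h⟩ := h₂ n φ g N hg
      exact ⟨w, hw.mono (le_max_left _ _), h⟩
    · obtain ⟨w, hw, h⟩ := h₃ n φ g N hg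
      exact ⟨w, hw.mono (le_max_right _ _), h⟩
  refine ⟨w, hw, fun i j hij hi hj l => ?_⟩
  have hnear : ∀ v : Fin n, v ≤ v.rev → v ∉ nearIndices n → v = 0 ∨ v = v.rev := fun v hv hv' => by
    rw [mem_nearIndices, Fin.pos_iff_ne_zero] at hv'
    by_contra! h
    exact hv' ⟨h.1, lt_of_le_of_ne hv h.2⟩
  have hrange : ∀ v : Fin n, v = 0 ∨ v = v.rev → ∀ b : Bool,
      ∃ x, φ.toFun x = if b then v.rev else v := fun v hv b => by
    apply hφ
    rcases hv with rfl | hv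
    · cases b <;> simp [Fin.val_rev]; omega
    · simp [← hv]
  obtain ⟨t, ht⟩ := φ.exists_facelet_eq (place i j l) fun c => by
    have : ∀ s, (![0, i, j] : Fin 3 → Fin n) s = 0 ∨
        (![0, i, j] : Fin 3 → Fin n) s = ((![0, i, j] : Fin 3 → Fin n) s).rev := by
      intro s
      fin_cases s
      · exact Or.inl rfl
      · exact hnear i hij.1 hi
      · exact hnear j hij.2.1 hj
    exact hrange _ (this (l.sym c)) (l.sign c)
  rw [← ht, hw', ht]
  rfl

/-! ### Combining the three stages -/

/-- Every product of moves can be brought, by few moves, to a permutation that respects the six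
sides of the cube. -/
theorem exists_solution :
    ∃ L K M : ℕ, ∀ (n : ℕ), 2 ≤ n → ∀ b : ℕ, 0 < b →
      ∀ (g : Equiv.Perm (Facelet n)) (N : ℕ), Cost g N →
      ∃ w : Equiv.Perm (Facelet n), Cost w (L + K * n + M * blockBound n b) ∧
        ∀ s, ((w * g) s).face = s.face := by
  obtain ⟨L, hL⟩ := exists_special
  obtain ⟨K, hK⟩ := exists_edges
  obtain ⟨M, hM⟩ := exists_interior
  refine ⟨L, K, M, fun n hn b hb g N hg => ?_⟩
  have : NeZero n := ⟨by omega⟩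
  obtain ⟨u, hu, hu'⟩ := hL n hn g N hg
  obtain ⟨v, hv, hv₁, hv₂⟩ := hK n hn (u * g) _ (hu.mul hg) hu'
  have hvg := hv.mul (hu.mul hg)
  choose π hπ using fun i j => exists_actsAs hvg i j
  have hα : ∀ π : Equiv.Perm Label, ∃ α ∈ alternatingGroup Label,
      ∀ l, ((α * π) l).1 = l.1 ∧ ((α * π) l).sign ((α * π) l).1 = l.sign l.1 := fun π => by
    rcases Int.units_eq_one_or (Equiv.Perm.sign π) with h | h
    · exact ⟨π⁻¹, by simp [h], by simp⟩
    -- The two swapped labels lie on the same side of the cube, so the leftover transposition is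
    -- invisible in the colors.
    · refine ⟨Equiv.swap (0, false, false, false) (0, false, true, false) * π⁻¹, ?_, ?_⟩
      · rw [Equiv.Perm.mem_alternatingGroup, Equiv.Perm.sign_mul, Equiv.Perm.sign_inv, h,
          Equiv.Perm.sign_swap (by decide)]
        rfl
      · rw [inv_mul_cancel_right]
        decide
  choose α hα hα' using hα
  obtain ⟨w, hw, hw'⟩ := hM n hn b hb (fun i j => α (π i j)) fun i j => hα _
  refine ⟨w * (v * u), ((hw.mul (hv.mul hu)).mono (le_of_eq (by ring))), fun s => ?_⟩
  rw [mul_assoc w, mul_assoc v]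
  obtain ⟨i, j, l, hij, rfl⟩ := exists_place_eq s
  by_cases hint : i ∈ nearIndices n ∧ j ∈ innerIndices n
  · have h := (hw' i j hij).mul (hπ i j)
    rw [if_pos hint] at h
    rw [h l]
    obtain ⟨h1, h2⟩ := hα' (π i j) l
    exact Prod.ext h1 h2
  · suffices h : ActsAs (v * (u * g)) i j 1 by
      have h := (hw' i j hij).mul h
      rw [if_neg hint] at h
      rw [h l]
      rfl
    by_cases hi : i ∈ nearIndices n
    · have hj : j = 0 := by
        by_contra hj
        exact hint ⟨hi, mem_innerIndices.2 ⟨Fin.pos_iff_ne_zero.2 hj, hij.2.1⟩⟩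
      subst hj
      exact (hv₂ i hi).1
    · by_cases hj : j ∈ nearIndices n
      · have hi0 : i = 0 := by
          by_contra h0
          refine hi (mem_nearIndices.2 ⟨Fin.pos_iff_ne_zero.2 h0, lt_of_le_of_ne hij.1 fun h => ?_⟩)
          exact (mem_nearIndices.1 hj).2.ne (hij.2.2 h)
        subst hi0
        simpa using (hv₂ j hj).2
      · exact hv₁ i j hij hi hj

/-! ### Configurations, and the numerical estimate -/

theorem Configuration.moves_append {n : ℕ} (c : Configuration n) (l l' : List (Move n)) :
    c.moves (l ++ l') = (c.moves l).moves l' := by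
  simp [Configuration.moves]

theorem Cost.exists_moves {n : ℕ} {g : Equiv.Perm (Facelet n)} {k : ℕ} (hg : Cost g k) :
    ∃ l : List (Move n), l.length ≤ k ∧
      ∀ (c : Configuration n) (s : Facelet n), c.moves l (g s) = c s := by
  obtain ⟨l, hl, hm, rfl⟩ := hg
  induction l generalizing k with
  | nil => exact ⟨[], by simp, fun c s => rfl⟩
  | cons x l ih =>
    obtain ⟨m, rfl⟩ := hm x List.mem_cons_self
    obtain ⟨t, ht, ht'⟩ := ih le_rfl fun y hy => hm y (List.mem_cons_of_mem _ hy)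
    refine ⟨t ++ [m], by simp at hl ⊢; omega, fun c s => ?_⟩
    rw [Configuration.moves_append, List.prod_cons, Equiv.Perm.mul_apply]
    change c.moves t (m.perm.symm (m.perm _)) = _
    rw [Equiv.symm_apply_apply, ht']

theorem exists_cost_of_moves {n : ℕ} (l : List (Move n)) :
    ∃ g : Equiv.Perm (Facelet n), Cost g l.length ∧
      ∀ (c : Configuration n) (s : Facelet n), c.moves l (g s) = c s := by
  induction l using List.reverseRecOn with
  | nil => exact ⟨1, Cost.one _, fun c s => rfl⟩
  | append_singleton l m ih =>
    obtain ⟨g, hg, h⟩ := ih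
    refine ⟨m.perm * g, ((Cost.perm m).mul hg).mono (by simp; omega), fun c s => ?_⟩
    rw [Configuration.moves_append, Equiv.Perm.mul_apply]
    change c.moves l (m.perm.symm (m.perm _)) = _
    rw [Equiv.symm_apply_apply, h]

/-- With `b = a + 1` and `a` half of `log₂ n` rounded down, `4 ^ a ≤ n` bounds the cost per block by
`18 * n`, and `n < 4 ^ b` gives `log n ≤ 2 * b`, so there are at most `4 * n / log n` blocks; and `4
* 18 = 72`. -/
theorem blockBound_le {n : ℕ} (hn : 2 ≤ n) :
    (blockBound n (Nat.log 2 n / 2 + 1) : ℝ) ≤ 72 * ((n : ℝ) ^ 2 / Real.log n) := by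
  set a := Nat.log 2 n / 2 with ha
  have hx : 2 ^ a * 2 ^ a ≤ n := by
    rw [← pow_add]
    exact (Nat.pow_le_pow_right (by norm_num) (by omega)).trans
      (Nat.pow_log_le_self 2 (by omega))
  have hax : a < 2 ^ a := Nat.lt_two_pow_self
  have h1 : 2 * n + 2 ^ (a + 1) * (2 * (a + 1) + 4) ≤ 18 * n := by
    have : 2 ^ (a + 1) * (2 * (a + 1) + 4) ≤ 16 * (2 ^ a * 2 ^ a) := by
      rw [pow_succ]
      calc 2 ^ a * 2 * (2 * (a + 1) + 4) ≤ 2 ^ a * 2 * (8 * 2 ^ a) :=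
            Nat.mul_le_mul_left _ (by omega)
        _ = _ := by ring
    omega
  have han : a + 1 ≤ n := by nlinarith
  have hb : (0 : ℝ) < (a + 1 : ℕ) := by positivity
  have hlog : 0 < Real.log n := Real.log_pos (by exact_mod_cast hn)
  have hlog' : Real.log n ≤ 2 * ((a + 1 : ℕ) : ℝ) := by
    have h2 : n ≤ 2 ^ (2 * (a + 1)) :=
      (Nat.lt_pow_succ_log_self (by norm_num) n).le.trans
        (Nat.pow_le_pow_right (by norm_num) (by omega))
    have h3 : Real.log n ≤ Real.log ((2 : ℝ) ^ (2 * (a + 1))) :=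
      Real.log_le_log (by positivity) (by exact_mod_cast h2)
    rw [Real.log_pow] at h3
    have h4 := Real.log_two_lt_d9
    push_cast at h3 ⊢
    nlinarith [Real.log_pos (one_lt_two : (1 : ℝ) < 2)]
  have h5 : ((n / (a + 1) + 1 : ℕ) : ℝ) ≤ 2 * (n / (a + 1 : ℕ)) := by
    have h6 : ((n / (a + 1) : ℕ) : ℝ) ≤ n / (a + 1 : ℕ) := Nat.cast_div_le
    have h7 : (1 : ℝ) ≤ n / (a + 1 : ℕ) := by
      rw [le_div_iff₀ hb, one_mul]
      exact_mod_cast han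
    rw [Nat.cast_succ]
    linarith
  have h8 : (n : ℝ) / (a + 1 : ℕ) ≤ 2 * (n / Real.log n) := by
    rw [div_le_iff₀ hb, mul_comm, ← mul_assoc, mul_div_assoc', le_div_iff₀ hlog]
    nlinarith [(Nat.cast_nonneg n : (0 : ℝ) ≤ n)]
  calc (blockBound n (a + 1) : ℝ) ≤ ((n / (a + 1) + 1 : ℕ) : ℝ) * (18 * n) := by
        rw [blockBound, Nat.cast_mul]
        exact mul_le_mul_of_nonneg_left (by exact_mod_cast h1) (Nat.cast_nonneg _)
    _ ≤ 2 * (2 * (n / Real.log n)) * (18 * n) := by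
        apply mul_le_mul_of_nonneg_right _ (by positivity)
        linarith
    _ = _ := by ring

end RubiksCube

theorem mainTheorem3 :
    ∃ C : ℝ, 0 < C ∧ ∀ n : ℕ, 2 ≤ n →
      ∀ c : RubiksCube.Configuration n, c.IsReachable →
        ∃ l : List (RubiksCube.Move n),
          (l.length : ℝ) ≤ C * ((n : ℝ) ^ 2 / Real.log n) ∧ (c.moves l).IsSolved := by
  obtain ⟨L, K, M, h⟩ := RubiksCube.exists_solution
  -- The terms `L` and `K * n` are absorbed using `1 ≤ n ≤ n ^ 2 / log n`; the summand `1` makes the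
  -- constant positive.
  refine ⟨L + K + 72 * M + 1, by positivity, fun n hn c hc => ?_⟩
  obtain ⟨c₀, ⟨col, hcol, hc₀⟩, l₀, rfl⟩ := hc
  obtain ⟨g, hg, hgc⟩ := RubiksCube.exists_cost_of_moves l₀
  obtain ⟨w, hw, hface⟩ := h n hn (Nat.log 2 n / 2 + 1) (Nat.succ_pos _) g _ hg
  obtain ⟨l, hl, hlc⟩ := hw.exists_moves
  refine ⟨l, ?_, col, hcol, fun s => ?_⟩
  · have hlog : 0 < Real.log n := Real.log_pos (by exact_mod_cast hn)
    have hn0 : (1 : ℝ) ≤ n := by exact_mod_cast (by omega : 1 ≤ n)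
    have h1 : (n : ℝ) ≤ (n : ℝ) ^ 2 / Real.log n := by
      rw [le_div_iff₀ hlog, sq]
      exact mul_le_mul_of_nonneg_left
        ((Real.log_le_sub_one_of_pos (by linarith)).trans (by linarith)) (by linarith)
    have h2 := RubiksCube.blockBound_le hn
    have h3 : (l.length : ℝ) ≤ L + K * n +
        M * RubiksCube.blockBound n (Nat.log 2 n / 2 + 1) := by exact_mod_cast hl
    have hL : (0 : ℝ) ≤ L := Nat.cast_nonneg _
    have hK : (0 : ℝ) ≤ K := Nat.cast_nonneg _
    have hM : (0 : ℝ) ≤ M := Nat.cast_nonneg _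
    nlinarith [mul_le_mul_of_nonneg_left h1 hK, mul_le_mul_of_nonneg_left h2 hM,
      mul_le_mul_of_nonneg_left (hn0.trans h1) hL]
  -- The color now seen at `w (g t)` came from `t`, and `w * g` keeps every facelet on its side, so
  -- the original coloring `col` still describes the result.
  · obtain ⟨t, rfl⟩ : ∃ t, w (g t) = s := ⟨g⁻¹ (w⁻¹ s), by simp⟩
    rw [hlc, hgc, hc₀]
    exact congrArg col (hface t).symm
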